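/- Let $K$ be a finite simplicial complex of dimension at most $d$ (the lattice) and $A\subseteq K$ a subcomplex (the region). Let $\partial A$ be its entangling surface: the subcomplex of all simplices of $A$ that are a face of some simplex of $K$ not in $A$. Write $K_{n,\partial A}$ for the set of $n$-simplices of $\partial A$, $C_A$ and $C_{\partial A}$ for the integral simplicial chain complexes of $A$ and $\partial A$, and $\beta_n$ for the $n$-th Betti number (the rank of the $n$-th integral homology group). For an Abelian higher gauge theory given by a chain complex $(G,\partial^G)$ of finite Abelian groups, the area term and the topological term of the entanglement entropy of $A$ are $$S_{\partial A}=\sum_{n=0}^{d-1}\sum_{p=1}^{d}(-1)^{p+1}\,|K_{n,\partial A}|\,\log|G_{n+p}|,$$ $$S_{\mathrm{Topo}}=\sum_{n=0}^{d}\log\bigl|H^n(C_A,H_n(G))\bigr|+\sum_{n=0}^{d-1}\sum_{p=1}^{d}(-1)^p\log\bigl|H^n(C_{\partial A},H_{n+p}(G))\bigr|.$$ Consider the $d$-dimensional Abelian 1-gauge theory (Abelian quantum double model), i.e. the case in which $G_1$ is a finite Abelian group and $G_n=0$ for all $n\neq 1$. Then $$S_{\partial A}=|K_{0,\partial A}|\,\log|G_1|,\qquad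 S_{\mathrm{Topo}}=\log\bigl|\mathrm{Hom}(H_1(C_A),G_1)\bigr|-\beta_0(\partial A)\,\log|G_1|.$$ In particular, if (the geometric realization of) $A$ is homeomorphic to the $d$-torus $T^d=(S^1)^d$, then $\beta_1(A)=d$ and $$S_{\mathrm{Topo}}=\bigl(\beta_1(A)-\beta_0(\partial A)\bigr)\log|G_1|.$$ -/

import Mathlib

open CategoryTheory

universe u v

namespace GaugeEntropy

section Simplicial

variable {V : Type v}

/-- The set `K_n` of `n`-simplices of `K`, i.e. of faces with `n + 1` vertices. -/
abbrev Simplices (K : PreAbstractSimplicialComplex V) (n : ℕ) : Type v :=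
  {s : Finset V // s ∈ K ∧ s.card = n + 1}

/-- The geometric realization `|K|`, in barycentric coordinates, as a subspace of `V → ℝ`
(the vertex set is finite). -/
def realization [Fintype V] (K : PreAbstractSimplicialComplex V) : Set (V → ℝ) :=
  {x | (∀ v, 0 ≤ x v) ∧ ∑ v, x v = 1 ∧ ∃ s ∈ K, ∀ v, v ∉ s → x v = 0}

/-- The entangling surface `∂A` of a region `A` in the lattice `K`: the simplices of `A` that are
a face of some simplex of `K` outside `A`. In the geometric realization this is the
triangulation of the topological frontier of `|A|` in `|K|`; its complement in `A` is the interior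
of `A`. -/
def entanglingSurface (K A : PreAbstractSimplicialComplex V) : PreAbstractSimplicialComplex V where
  faces := {s | s ∈ A ∧ ∃ t ∈ K, t ∉ A ∧ s ⊆ t}
  isRelLowerSet_faces := by
    rintro s ⟨hs, t, ht, htA, hst⟩
    refine ⟨(A.isRelLowerSet_faces hs).1, fun r hr hne => ?_⟩
    exact ⟨(A.isRelLowerSet_faces hs).2 hr hne, t, ht, htA, fun x hx => hst (hr hx)⟩

variable [LinearOrder V]

/-- The face of an `(n+1)`-simplex opposite to its vertex `v`. -/
def oppositeFace {K : PreAbstractSimplicialComplex V} {n : ℕ} (s : Simplices K (n + 1))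
    (v : {x // x ∈ s.1}) : Simplices K n :=
  ⟨s.1.erase v.1, by
    have hc : (s.1.erase v.1).card = n + 1 := by
      rw [Finset.card_erase_of_mem v.2, s.2.2]; rfl
    refine ⟨(K.isRelLowerSet_faces s.2.1).2 (Finset.erase_subset _ _) ?_, hc⟩
    exact Finset.card_pos.mp (by omega)⟩

/-- `(-1)^i`, where `v` is the `i`-th vertex (counted from `0`) of `s`. -/
def faceSign (s : Finset V) (v : V) : ℤ := (-1) ^ (s.filter (· < v)).card

/-- The simplicial boundary map `∂ₙ₊₁ : Cₙ₊₁(K) → Cₙ(K)`,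
`[v₀, …, vₙ₊₁] ↦ ∑ᵢ (-1)^i [v₀, …, v̂ᵢ, …, vₙ₊₁]` for `v₀ < ⋯ < vₙ₊₁`. -/
noncomputable def boundary (K : PreAbstractSimplicialComplex V) (n : ℕ) :
    (Simplices K (n + 1) →₀ ℤ) →+ (Simplices K n →₀ ℤ) :=
  Finsupp.liftAddHom fun s => zmultiplesHom _
    (∑ v : {x // x ∈ s.1}, faceSign s.1 v.1 • Finsupp.single (oppositeFace s v) (1 : ℤ))

theorem boundary_single (K : PreAbstractSimplicialComplex V) (n : ℕ) (s : Simplices K (n + 1)) :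
    boundary K n (Finsupp.single s 1) =
      ∑ v : {x // x ∈ s.1}, faceSign s.1 v.1 • Finsupp.single (oppositeFace s v) (1 : ℤ) := by
  simp [boundary]

theorem faceSign_swap (s : Finset V) {v w : V} (hv : v ∈ s) (h : v < w) :
    faceSign s v * faceSign (s.erase v) w + faceSign s w * faceSign (s.erase w) v = 0 := by
  have h1 : (s.erase w).filter (· < v) = s.filter (· < v) := by
    ext x
    simp only [Finset.mem_filter, Finset.mem_erase]
    exact ⟨fun hx => ⟨hx.1.2, hx.2⟩, fun hx => ⟨⟨(hx.2.trans h).ne, hx.1⟩, hx.2⟩⟩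
  have h2 : (s.erase v).filter (· < w) = (s.filter (· < w)).erase v := by
    ext x
    simp only [Finset.mem_filter, Finset.mem_erase, and_assoc]
  have h3 : v ∈ s.filter (· < w) := Finset.mem_filter.mpr ⟨hv, h⟩
  have h4 : (s.filter (· < w)).card = ((s.erase v).filter (· < w)).card + 1 := by
    rw [h2, Finset.card_erase_add_one h3]
  unfold faceSign
  rw [h1, h4, pow_succ]
  ring

theorem boundary_comp_boundary (K : PreAbstractSimplicialComplex V) (n : ℕ) :
    (boundary K n).comp (boundary K (n + 1)) = 0 := by
  refine Finsupp.addHom_ext' fun s => AddMonoidHom.ext_int ?_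
  simp only [AddMonoidHom.comp_apply, Finsupp.singleAddHom_apply, AddMonoidHom.zero_apply]
  rw [boundary_single, map_sum]
  simp only [map_zsmul, boundary_single, Finset.smul_sum, smul_smul]
  rw [Finset.sum_sigma']
  refine Finset.sum_involution
    (fun a _ => ⟨⟨a.2.1, (Finset.mem_erase.mp a.2.2).2⟩,
      ⟨a.1.1, Finset.mem_erase.mpr ⟨(Finset.mem_erase.mp a.2.2).1.symm, a.1.2⟩⟩⟩)
    ?_ ?_ ?_ ?_
  · rintro ⟨⟨v, hv⟩, ⟨w, hw⟩⟩ _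
    obtain ⟨hne, hw'⟩ := Finset.mem_erase.mp hw
    have hface : oppositeFace (oppositeFace s ⟨v, hv⟩) ⟨w, hw⟩ =
        oppositeFace (oppositeFace s ⟨w, hw'⟩) ⟨v, Finset.mem_erase.mpr ⟨hne.symm, hv⟩⟩ :=
      Subtype.ext Finset.erase_right_comm
    rw [hface, ← add_smul]
    have : faceSign s.1 v * faceSign (s.1.erase v) w
        + faceSign s.1 w * faceSign (s.1.erase w) v = 0 := by
      rcases lt_or_gt_of_ne hne with h | h
      · rw [add_comm]; exact faceSign_swap s.1 hw' h
      · exact faceSign_swap s.1 hv h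
    change (faceSign s.1 v * faceSign (s.1.erase v) w
        + faceSign s.1 w * faceSign (s.1.erase w) v) • _ = _
    rw [this, zero_smul]
  · rintro ⟨⟨v, hv⟩, ⟨w, hw⟩⟩ _ _ h
    have h1 : w = v := congrArg (fun a => a.1.1) h
    exact (Finset.mem_erase.mp hw).1 h1
  · intros; exact Finset.mem_univ _
  · intros; rfl

/-- The simplicial chain complex `C(K)`: `Cₙ(K)` is the free abelian group on the `n`-simplices. -/
noncomputable def chains (K : PreAbstractSimplicialComplex V) : ChainComplex AddCommGrpCat.{v} ℕ :=
  ChainComplex.of (fun n => AddCommGrpCat.of (Simplices K n →₀ ℤ))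
    (fun n => AddCommGrpCat.ofHom (boundary K n))
    (fun n => by
      rw [← AddCommGrpCat.ofHom_comp, boundary_comp_boundary]
      rfl)

end Simplicial

section Coefficients

/-- `n`-cocycles of `C` with values in `D`: homomorphisms `f : Cₙ → D` with `f ∘ ∂ₙ₊₁ = 0`. -/
def cocycles (C : ChainComplex AddCommGrpCat.{v} ℕ) (D : Type u) [AddCommGroup D] (n : ℕ) :
    AddSubgroup (C.X n →+ D) :=
  (AddMonoidHom.compHom' (P := D) (C.d (n + 1) n).hom).ker

/-- `n`-coboundaries of `C` with values in `D`: homomorphisms of the form `g ∘ ∂ₙ` with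
`g : Cₙ₋₁ → D`. For `n = 0` the differential `C.d 0 (0 - 1) = C.d 0 0` is zero, so that only the
zero homomorphism is a `0`-coboundary. -/
def coboundaries (C : ChainComplex AddCommGrpCat.{v} ℕ) (D : Type u) [AddCommGroup D] (n : ℕ) :
    AddSubgroup (C.X n →+ D) :=
  (AddMonoidHom.compHom' (P := D) (C.d n (n - 1)).hom).range

/-- The cohomology group `Hⁿ(C, D)` with coefficients in `D`. -/
abbrev Cohomology (C : ChainComplex AddCommGrpCat.{v} ℕ) (D : Type u) [AddCommGroup D] (n : ℕ) :
    Type (max u v) :=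
  cocycles C D n ⧸ (coboundaries C D n).addSubgroupOf (cocycles C D n)

/-- The `n`-th Betti number of `C`: the rank of the integral homology group `Hₙ(C)`. -/
noncomputable def betti (C : ChainComplex AddCommGrpCat.{v} ℕ) (n : ℕ) : ℕ :=
  Module.finrank ℤ (C.homology n)

end Coefficients

section Entropy

variable {V : Type v} [LinearOrder V]

/-- The area term of the entanglement entropy of the region `A` of the `d`-dimensional lattice `K`,
for the Abelian higher gauge theory with chain complex of gauge groups `G`:
`S_∂A = ∑_{n=0}^{d-1} ∑_{p=1}^{d} (-1)^{p+1} |K_{n,∂A}| log |G_{n+p}|`. -/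
noncomputable def areaTerm (d : ℕ) (K A : PreAbstractSimplicialComplex V)
    (G : ChainComplex AddCommGrpCat.{u} ℕ) : ℝ :=
  ∑ n ∈ Finset.range d, ∑ p ∈ Finset.Icc 1 d,
    (-1 : ℝ) ^ (p + 1) * (Nat.card (Simplices (entanglingSurface K A) n) : ℝ)
      * Real.log (Nat.card (G.X (n + p)))

/-- The topological term of the entanglement entropy of the region `A` of the `d`-dimensional
lattice `K`, for the Abelian higher gauge theory with chain complex of gauge groups `G`:
`S_Topo = ∑_{n=0}^{d} log |Hⁿ(C_A, Hₙ(G))|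
  + ∑_{n=0}^{d-1} ∑_{p=1}^{d} (-1)^p log |Hⁿ(C_∂A, H_{n+p}(G))|`. -/
noncomputable def topologicalTerm (d : ℕ) (K A : PreAbstractSimplicialComplex V)
    (G : ChainComplex AddCommGrpCat.{u} ℕ) : ℝ :=
  ∑ n ∈ Finset.range (d + 1), Real.log (Nat.card (Cohomology (chains A) (G.homology n) n))
    + ∑ n ∈ Finset.range d, ∑ p ∈ Finset.Icc 1 d,
        (-1 : ℝ) ^ p * Real.log (Nat.card
          (Cohomology (chains (entanglingSurface K A)) (G.homology (n + p)) n))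

end Entropy

end GaugeEntropy

/-!
When `G` is concentrated in degree `1`, all summands but `log |H¹(C_A, G₁)|` and
`-log |H⁰(C_∂A, G₁)|` of the topological term vanish. Over an arbitrary coefficient group,
`Hⁿ(C, D) ≃ Hom(Hₙ(C), D)` for `n ≤ 1`: the Ext term comes from `Hₙ₋₁`, and `H₀` is free because
the image of `∂₁` splits off (paths to base points give a generalized inverse of `∂₁`). Finally
`H₀(∂A)` is free of rank `β₀(∂A)`.

For the torus one needs that `H¹(A, D)` depends only on the realization. Call a function `f` of
two points of a metric space a small cocycle if `f x y + f y z = f x z` for sufficiently close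
points, and a small coboundary if `f x y = g y - g x` for sufficiently close points; the quotient
is invariant under homeomorphisms of compact spaces, which are uniformly continuous. A simplicial
cocycle becomes a small cocycle on the realization by sending a point to a vertex with maximal
barycentric coordinate. Small cocycles on star-convex sets are small coboundaries, and two
primitives on a connected set differ by a constant; applied to the closed stars of vertices and
edges, this recovers the simplicial cocycle. Applied to the universal covering of the torus, it
identifies the class of a small cocycle with its periods along the coordinate circles, so that
`Hom(H₁(A), D) ≃ Dᵈ`. The Betti number is the case `D = ℚ`.
-/

namespace GaugeEntropy

section Subquotient

variable {A B : Type*} [AddCommGroup A] [AddCommGroup B]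

/-- The isomorphism `A ⧸ N ≃+ Z ⧸ M` induced by a homomorphism `φ : A →+ B` with values in `Z`
whose composition with the projection modulo `M` is onto with kernel `N`. -/
noncomputable def quotientEquivSubquotient (φ : A →+ B) {N : AddSubgroup A} {Z M : AddSubgroup B}
    (mem : ∀ a, φ a ∈ Z) (mem_iff : ∀ a, φ a ∈ M ↔ a ∈ N) (surj : ∀ z ∈ Z, ∃ a, φ a - z ∈ M) :
    A ⧸ N ≃+ Z ⧸ M.addSubgroupOf Z :=
  let π : A →+ Z ⧸ M.addSubgroupOf Z := (QuotientAddGroup.mk' _).comp (φ.codRestrict Z mem)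
  have ker_π : N = π.ker := by
    ext a
    exact (mem_iff a).symm.trans
      (QuotientAddGroup.eq_zero_iff (N := M.addSubgroupOf Z) ⟨φ a, mem a⟩).symm
  have surjective_π : Function.Surjective π := by
    rintro ⟨z, hz⟩
    obtain ⟨a, ha⟩ := surj z hz
    exact ⟨a, QuotientAddGroup.eq_iff_sub_mem.mpr ha⟩
  (QuotientAddGroup.quotientAddEquivOfEq ker_π).trans
    (QuotientAddGroup.quotientKerEquivOfSurjective π surjective_π)

end Subquotient

section Homology

variable (C : ChainComplex AddCommGrpCat.{v} ℕ) (n : ℕ)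

/-- The group of `n`-cycles of `C`. -/
abbrev cycles : AddSubgroup (C.X n) := (C.d n (n - 1)).hom.ker

theorem d_apply_mem_cycles (x : C.X (n + 1)) : (C.d (n + 1) n).hom x ∈ cycles C n :=
  DFunLike.congr_fun (congrArg AddCommGrpCat.Hom.hom (C.d_comp_d (n + 1) n (n - 1))) x

/-- The `n`-boundaries of `C`, as a subgroup of the group of `n`-cycles. -/
def boundariesInCycles : AddSubgroup (cycles C n) :=
  ((C.d (n + 1) n).hom.codRestrict (cycles C n) (d_apply_mem_cycles C n)).range

/-- The homology of `C`, as defined by the library, is cycles modulo boundaries. -/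
noncomputable def homologyEquiv : C.homology n ≃+ cycles C n ⧸ boundariesInCycles C n :=
  have next_eq : (ComplexShape.down ℕ).next n = n - 1 := by cases n <;> simp
  (ShortComplex.homologyMapIso (C.isoSc' (n + 1) n (n - 1) (by simp) next_eq) ≪≫
    (C.sc' (n + 1) n (n - 1)).abHomologyIso).addCommGroupIsoToAddEquiv

variable {C n} in
theorem mk_eq_zero_iff_exists_d_eq (z : cycles C n) :
    (z : cycles C n ⧸ boundariesInCycles C n) = 0 ↔ ∃ x, (C.d (n + 1) n).hom x = z :=
  (QuotientAddGroup.eq_zero_iff z).trans <| exists_congr fun _ => Subtype.ext_iff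

instance subsingleton_homology [Subsingleton (C.X n)] : Subsingleton (C.homology n) :=
  have : Subsingleton (cycles C n ⧸ boundariesInCycles C n) :=
    QuotientAddGroup.mk_surjective.subsingleton
  (homologyEquiv C n).injective.subsingleton

/-- The homology of `C` in degree `n` is `Cₙ` when the neighbouring groups vanish. -/
noncomputable def homologyEquivX [Subsingleton (C.X (n + 1))] [Subsingleton (C.X (n - 1))] :
    C.homology n ≃+ C.X n :=
  have boundaries_eq : boundariesInCycles C n = ⊥ := by
    rw [eq_bot_iff]
    rintro _ ⟨x, rfl⟩
    rw [Subsingleton.elim x 0, map_zero]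
    exact rfl
  have cycles_eq : cycles C n = ⊤ := eq_top_iff.mpr fun _ _ => Subsingleton.elim _ _
  (homologyEquiv C n).trans <| (QuotientAddGroup.quotientAddEquivOfEq boundaries_eq).trans <|
    QuotientAddGroup.quotientBot.trans <|
      (AddEquiv.addSubgroupCongr cycles_eq).trans AddSubgroup.topEquiv

end Homology

section UniversalCoefficients

variable (C : ChainComplex AddCommGrpCat.{v} ℕ) (D : Type u) [AddCommGroup D] (n : ℕ)

/-- The Kronecker pairing, sending an `n`-cocycle to its evaluation on homology classes. -/
def kronecker : cocycles C D n →+ (cycles C n ⧸ boundariesInCycles C n →+ D) where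
  toFun f := QuotientAddGroup.lift _ (f.1.comp (cycles C n).subtype) <| by
    rintro _ ⟨x, rfl⟩
    exact DFunLike.congr_fun f.2 x
  map_zero' := by ext; rfl
  map_add' _ _ := by ext; rfl

variable {C D n} {Γ : C.X (n - 1) →+ C.X n}

theorem sub_generalizedInverse_mem_cycles
    (hΓ : ∀ x, (C.d n (n - 1)).hom (Γ ((C.d n (n - 1)).hom x)) = (C.d n (n - 1)).hom x)
    (x : C.X n) : x - Γ ((C.d n (n - 1)).hom x) ∈ cycles C n := by
  simp [AddMonoidHom.mem_ker, hΓ]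

theorem kronecker_surjective
    (hΓ : ∀ x, (C.d n (n - 1)).hom (Γ ((C.d n (n - 1)).hom x)) = (C.d n (n - 1)).hom x) :
    Function.Surjective (kronecker C D n) := by
  intro φ
  let r : C.X n →+ cycles C n :=
    (AddMonoidHom.id _ - Γ.comp (C.d n (n - 1)).hom).codRestrict _
      (sub_generalizedInverse_mem_cycles hΓ)
  have retraction (z : cycles C n) : r z = z := by
    have hz : (C.d n (n - 1)).hom z = 0 := z.2
    exact Subtype.ext (show z.1 - Γ ((C.d n (n - 1)).hom z) = z by rw [hz, map_zero, sub_zero])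
  refine ⟨⟨(φ.comp (QuotientAddGroup.mk' _)).comp r, ?_⟩, ?_⟩
  · ext x
    change φ (r ((C.d (n + 1) n).hom x) : cycles C n) = 0
    rw [retraction ⟨_, d_apply_mem_cycles C n x⟩, (mk_eq_zero_iff_exists_d_eq _).mpr ⟨x, rfl⟩,
      map_zero]
  · ext z
    exact congrArg (fun z : cycles C n => φ z) (retraction z)

theorem ker_kronecker
    (hΓ : ∀ x, (C.d n (n - 1)).hom (Γ ((C.d n (n - 1)).hom x)) = (C.d n (n - 1)).hom x) :
    (kronecker C D n).ker = (coboundaries C D n).addSubgroupOf (cocycles C D n) := by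
  ext f
  constructor
  · intro hf
    refine ⟨f.1.comp Γ, AddMonoidHom.ext fun x => ?_⟩
    let z : cycles C n := ⟨_, sub_generalizedInverse_mem_cycles hΓ x⟩
    have eval_eq_zero : f.1 (x - Γ ((C.d n (n - 1)).hom x)) = 0 :=
      DFunLike.congr_fun (AddMonoidHom.mem_ker.mp hf) (QuotientAddGroup.mk z)
    rw [map_sub, sub_eq_zero] at eval_eq_zero
    exact eval_eq_zero.symm
  · rintro ⟨g, hg⟩
    ext z
    have hz : (C.d n (n - 1)).hom z = 0 := z.2
    calc f.1 z = g ((C.d n (n - 1)).hom z) := DFunLike.congr_fun hg.symm z.1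
      _ = 0 := by rw [hz, map_zero]

/-- The universal coefficient isomorphism `Hⁿ(C, D) ≃ Hom(Hₙ(C), D)`, in the case where the
differential of `Cₙ` has a generalized inverse. -/
noncomputable def cohomologyEquivOfGeneralizedInverse
    (hΓ : ∀ x, (C.d n (n - 1)).hom (Γ ((C.d n (n - 1)).hom x)) = (C.d n (n - 1)).hom x) :
    Cohomology C D n ≃+ (C.homology n →+ D) :=
  (QuotientAddGroup.quotientAddEquivOfEq (ker_kronecker hΓ).symm).trans <|
    (QuotientAddGroup.quotientKerEquivOfSurjective _ (kronecker_surjective hΓ)).trans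
      (homologyEquiv C n).addMonoidHomCongrLeft.symm

theorem exists_injective_homology_of_generalizedInverse {Γ : C.X n →+ C.X (n + 1)}
    (hΓ : ∀ x, (C.d (n + 1) n).hom (Γ ((C.d (n + 1) n).hom x)) = (C.d (n + 1) n).hom x) :
    ∃ j : C.homology n →+ C.X n, Function.Injective j := by
  let p : cycles C n →+ C.X n :=
    (AddMonoidHom.id _ - (C.d (n + 1) n).hom.comp Γ).comp (cycles C n).subtype
  have p_boundary : boundariesInCycles C n ≤ p.ker := by
    rintro _ ⟨x, rfl⟩
    exact sub_eq_zero.mpr (hΓ x).symm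
  have lift_injective : Function.Injective (QuotientAddGroup.lift _ p p_boundary) := by
    rw [injective_iff_map_eq_zero]
    rintro ⟨z⟩ hz
    exact (mk_eq_zero_iff_exists_d_eq z).mpr ⟨Γ z, (sub_eq_zero.mp hz).symm⟩
  exact ⟨(QuotientAddGroup.lift _ p p_boundary).comp (homologyEquiv C n).toAddMonoidHom,
    lift_injective.comp (homologyEquiv C n).injective⟩

end UniversalCoefficients

section Chains

theorem exists_lt_of_card_eq_two {V : Type*} [LinearOrder V] {s : Finset V} (hs : s.card = 2) :
    ∃ u v, u < v ∧ s = {u, v} := by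
  obtain ⟨u, v, huv, rfl⟩ := Finset.card_eq_two.mp hs
  rcases lt_or_gt_of_ne huv with h | h
  · exact ⟨u, v, h, rfl⟩
  · exact ⟨v, u, h, Finset.pair_comm u v⟩

theorem exists_lt_lt_of_card_eq_three {V : Type*} [LinearOrder V] {s : Finset V}
    (hs : s.card = 3) : ∃ u v w, u < v ∧ v < w ∧ s = {u, v, w} := by
  let f := s.orderEmbOfFin hs
  refine ⟨f 0, f 1, f 2, f.strictMono (by decide), f.strictMono (by decide), ?_⟩
  rw [← Finset.image_orderEmbOfFin_univ s hs]
  simp [f, Fin.univ_succ]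

variable {V : Type v} {K : PreAbstractSimplicialComplex V} {n : ℕ}

theorem mem_of_subset {s t : Finset V} (ht : t ∈ K) (hst : s ⊆ t) (hs : s.Nonempty) : s ∈ K :=
  K.isRelLowerSet_faces.mem_of_le ht hst hs

open Classical in
variable (K n) in
/-- The generator of `Cₙ(K)` given by `s`, or `0` if `s` is not an `n`-simplex of `K`. -/
noncomputable def elementaryChain (s : Finset V) : Simplices K n →₀ ℤ :=
  if hs : s ∈ K ∧ s.card = n + 1 then Finsupp.single ⟨s, hs⟩ 1 else 0

theorem single_eq_elementaryChain (s : Simplices K n) :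
    Finsupp.single s 1 = elementaryChain K n s.1 := by
  rw [elementaryChain, dif_pos s.2]

theorem elementaryChain_eq_zero {s : Finset V} (hs : s.card ≠ n + 1) :
    elementaryChain K n s = 0 :=
  dif_neg fun h => hs h.2

theorem chain_hom_ext {M : Type*} [AddCommGroup M] {f g : (Simplices K n →₀ ℤ) →+ M}
    (h : ∀ s ∈ K, s.card = n + 1 → f (elementaryChain K n s) = g (elementaryChain K n s)) :
    f = g := by
  refine Finsupp.addHom_ext' fun s => AddMonoidHom.ext_int ?_
  simpa only [AddMonoidHom.comp_apply, Finsupp.singleAddHom_apply, single_eq_elementaryChain]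
    using h s.1 s.2.1 s.2.2

variable (K n) in
/-- The homomorphism on `Cₙ(K)` with prescribed values on the simplices. -/
noncomputable def chainLift {M : Type*} [AddCommGroup M] (φ : Finset V → M) :
    (Simplices K n →₀ ℤ) →+ M :=
  Finsupp.liftAddHom fun s => zmultiplesHom _ (φ s.1)

theorem chainLift_elementaryChain {M : Type*} [AddCommGroup M] (φ : Finset V → M)
    {s : Finset V} (hs : s ∈ K) (hn : s.card = n + 1) :
    chainLift K n φ (elementaryChain K n s) = φ s := by
  rw [← single_eq_elementaryChain ⟨s, hs, hn⟩]
  simp [chainLift]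

variable [LinearOrder V]

theorem boundary_elementaryChain {s : Finset V} (hs : s ∈ K) (hn : s.card = n + 2) :
    boundary K n (elementaryChain K (n + 1) s) =
      ∑ v ∈ s, faceSign s v • elementaryChain K n (s.erase v) := by
  rw [← single_eq_elementaryChain ⟨s, hs, hn⟩, boundary_single,
    ← Finset.sum_coe_sort s fun v => faceSign s v • elementaryChain K n (s.erase v)]
  simp only [single_eq_elementaryChain]
  rfl

theorem boundary_pair {u v : V} (huv : u < v) (hK : {u, v} ∈ K) :
    boundary K 0 (elementaryChain K 1 {u, v}) =
      elementaryChain K 0 {v} - elementaryChain K 0 {u} := by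
  have erase_u : ({u, v} : Finset V).erase u = {v} := by grind
  have erase_v : ({u, v} : Finset V).erase v = {u} := by grind
  have sign_u : faceSign {u, v} u = 1 := by
    simp [faceSign, Finset.filter_insert, Finset.filter_singleton, huv.not_gt]
  have sign_v : faceSign {u, v} v = -1 := by
    simp [faceSign, Finset.filter_insert, Finset.filter_singleton, huv]
  rw [boundary_elementaryChain hK (Finset.card_pair huv.ne), Finset.sum_pair huv.ne,
    erase_u, erase_v, sign_u, sign_v]
  abel

theorem boundary_triple {u v w : V} (huv : u < v) (hvw : v < w) (hK : {u, v, w} ∈ K) :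
    boundary K 1 (elementaryChain K 2 {u, v, w}) =
      elementaryChain K 1 {v, w} - elementaryChain K 1 {u, w} + elementaryChain K 1 {u, v} := by
  have huw := huv.trans hvw
  have u_notMem : u ∉ ({v, w} : Finset V) := by simp [huv.ne, huw.ne]
  have erase_u : ({u, v, w} : Finset V).erase u = {v, w} := by grind
  have erase_v : ({u, v, w} : Finset V).erase v = {u, w} := by grind
  have erase_w : ({u, v, w} : Finset V).erase w = {u, v} := by grind
  have sign_u : faceSign {u, v, w} u = 1 := by
    simp [faceSign, Finset.filter_insert, Finset.filter_singleton, huv.not_gt, huw.not_gt]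
  have sign_v : faceSign {u, v, w} v = -1 := by
    simp [faceSign, Finset.filter_insert, Finset.filter_singleton, huv, hvw.not_gt]
  have sign_w : faceSign {u, v, w} w = 1 := by
    simp [faceSign, Finset.filter_insert, Finset.filter_singleton, huw, hvw,
      Finset.card_pair huv.ne]
  rw [boundary_elementaryChain hK (by rw [Finset.card_insert_of_notMem u_notMem,
      Finset.card_pair hvw.ne]), Finset.sum_insert u_notMem, Finset.sum_pair hvw.ne,
    erase_u, erase_v, erase_w, sign_u, sign_v, sign_w]
  abel

theorem edge_hom_ext {M : Type*} [AddCommGroup M] {f g : (Simplices K 1 →₀ ℤ) →+ M}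
    (h : ∀ u v, u < v → {u, v} ∈ K →
      f (elementaryChain K 1 {u, v}) = g (elementaryChain K 1 {u, v})) : f = g := by
  refine chain_hom_ext fun s hs hn => ?_
  obtain ⟨u, v, huv, rfl⟩ := exists_lt_of_card_eq_two hn
  exact h u v huv hs

variable (K n) in
theorem chains_d : ((chains K).d (n + 1) n).hom = boundary K n :=
  congrArg AddCommGrpCat.Hom.hom <|
    ChainComplex.of_d (fun n => AddCommGrpCat.of (Simplices K n →₀ ℤ))
      (fun n => AddCommGrpCat.ofHom (boundary K n)) n

variable (K) in
/-- The generalized inverse joins each vertex by a path to the base point of its component. -/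
theorem exists_boundary_generalizedInverse :
    ∃ Γ : (Simplices K 0 →₀ ℤ) →+ (Simplices K 1 →₀ ℤ),
      ∀ x, boundary K 0 (Γ (boundary K 0 x)) = boundary K 0 x := by
  let component (s : Finset V) : (Simplices K 0 →₀ ℤ) ⧸ (boundary K 0).range :=
    QuotientAddGroup.mk (elementaryChain K 0 s)
  let base := Function.invFun component ∘ component
  have component_base (s) : component (base s) = component s :=
    Function.invFun_eq ⟨s, rfl⟩
  have exists_path (s) :
      ∃ γ, boundary K 0 γ = -elementaryChain K 0 (base s) + elementaryChain K 0 s :=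
    QuotientAddGroup.eq.mp (component_base s)
  choose path boundary_path using exists_path
  refine ⟨chainLift K 0 path, DFunLike.congr_fun
    (f := ((boundary K 0).comp (chainLift K 0 path)).comp (boundary K 0)) <|
      edge_hom_ext fun u v huv hK => ?_⟩
  have vertex_mem {x : V} (hx : x ∈ ({u, v} : Finset V)) : {x} ∈ K :=
    mem_of_subset hK (Finset.singleton_subset_iff.mpr hx) (Finset.singleton_nonempty x)
  have base_eq : base {u} = base {v} := congrArg (Function.invFun component) <|
    QuotientAddGroup.eq.mpr ⟨_, (boundary_pair huv hK).trans (by abel)⟩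
  simp only [AddMonoidHom.comp_apply, boundary_pair huv hK, map_sub]
  rw [chainLift_elementaryChain path (vertex_mem (by simp)) (Finset.card_singleton v),
    chainLift_elementaryChain path (vertex_mem (by simp)) (Finset.card_singleton u),
    boundary_path, boundary_path, base_eq]
  abel

variable (K) in
theorem exists_chains_d_generalizedInverse :
    ∃ Γ : (chains K).X 0 →+ (chains K).X 1,
      ∀ x, ((chains K).d 1 0).hom (Γ (((chains K).d 1 0).hom x)) = ((chains K).d 1 0).hom x := by
  rw [show ((chains K).d 1 0).hom = boundary K 0 from chains_d K 0]
  exact exists_boundary_generalizedInverse K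

variable (K) in
/-- `H¹(K, D) ≃ Hom(H₁(K), D)`. -/
noncomputable def cohomologyOneEquiv (D : Type u) [AddCommGroup D] :
    Cohomology (chains K) D 1 ≃+ ((chains K).homology 1 →+ D) :=
  cohomologyEquivOfGeneralizedInverse (exists_chains_d_generalizedInverse K).choose_spec

/-- `H⁰(C, D) ≃ Hom(H₀(C), D)`. -/
noncomputable def cohomologyZeroEquiv (C : ChainComplex AddCommGrpCat.{v} ℕ) (D : Type u)
    [AddCommGroup D] : Cohomology C D 0 ≃+ (C.homology 0 →+ D) :=
  cohomologyEquivOfGeneralizedInverse (Γ := 0) fun x => by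
    rw [C.shape 0 (0 - 1) (by simp)]
    rfl

theorem exists_injective_homology_zero :
    ∃ j : (chains K).homology 0 →ₗ[ℤ] (Simplices K 0 →₀ ℤ), Function.Injective j :=
  have ⟨_, hΓ⟩ := exists_chains_d_generalizedInverse K
  have ⟨j, hj⟩ := exists_injective_homology_of_generalizedInverse hΓ
  ⟨AddMonoidHom.toIntLinearMap j, hj⟩

instance finite_homology_zero [Finite V] : Module.Finite ℤ ((chains K).homology 0) :=
  have ⟨j, hj⟩ := exists_injective_homology_zero (K := K)
  Module.Finite.of_injective j hj

instance free_homology_zero [Finite V] : Module.Free ℤ ((chains K).homology 0) :=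
  have ⟨j, hj⟩ := exists_injective_homology_zero (K := K)
  Module.Free.of_equiv (LinearEquiv.ofInjective j hj).symm

end Chains

section Dual

variable (M : Type*) [AddCommGroup M]

theorem card_addMonoidHom_of_free [Module.Free ℤ M] [Module.Finite ℤ M] (D : Type*)
    [AddCommGroup D] : Nat.card (M →+ D) = Nat.card D ^ Module.finrank ℤ M := by
  let b := Module.Free.chooseBasis ℤ M
  let e : (M →+ D) ≃ (Module.Free.ChooseBasisIndex ℤ M → D) :=
    (addMonoidHomLequivInt (A := M) (B := D) ℤ).toEquiv.trans (b.constr ℤ).symm.toEquiv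
  rw [Nat.card_congr e, Nat.card_fun, Module.finrank_eq_card_chooseBasisIndex,
    Nat.card_eq_fintype_card (α := Module.Free.ChooseBasisIndex ℤ M)]

theorem finrank_addMonoidHom_rat : Module.finrank ℚ (M →+ ℚ) = Module.finrank ℤ M := by
  let e : (M →+ ℚ) ≃+ Module.Dual ℚ (TensorProduct ℤ ℚ M) :=
    (addMonoidHomLequivInt (A := M) (B := ℚ) ℤ).toAddEquiv.trans
      (LinearMap.liftBaseChangeEquiv (R := ℤ) (M := M) (N := ℚ) ℚ).toAddEquiv
  have e' : (M →+ ℚ) ≃ₗ[ℚ] Module.Dual ℚ (TensorProduct ℤ ℚ M) :=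
    { e with map_smul' := fun c x => map_rat_smul e.toAddMonoidHom c x }
  rw [e'.finrank_eq, Subspace.dual_finrank_eq, IsFractionRing.finrank_right_eq ℤ ℚ,
    ← IsLocalizedModule.finrank_eq (nonZeroDivisors ℤ) (TensorProduct.mk ℤ ℚ M 1) le_rfl]
  congr 1

end Dual

section OrderedCochains

variable {V : Type*} [DecidableEq V] (K : PreAbstractSimplicialComplex V)
variable (D : Type*) [AddCommGroup D]

/-- Ordered simplicial `1`-cocycles: functions of two vertices, additive on triples of vertices
spanning a possibly degenerate simplex. -/
def orderedCocycles : AddSubgroup (V → V → D) where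
  carrier := {c | ∀ u v w, {u, v, w} ∈ K → c u v + c v w = c u w}
  zero_mem' _ _ _ _ := add_zero 0
  add_mem' {f g} hf hg u v w h := by
    simp only [Pi.add_apply, ← hf u v w h, ← hg u v w h]
    abel
  neg_mem' {f} hf u v w h := by
    simp only [Pi.neg_apply, ← hf u v w h]
    abel

/-- Ordered simplicial `1`-coboundaries. -/
def orderedCoboundaries : AddSubgroup (V → V → D) where
  carrier := {c | ∃ g : V → D, ∀ u v, {u, v} ∈ K → c u v = g v - g u}
  zero_mem' := ⟨0, fun _ _ _ => (sub_zero 0).symm⟩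
  add_mem' := by
    rintro f f' ⟨g, hf⟩ ⟨g', hf'⟩
    refine ⟨g + g', fun u v h => ?_⟩
    simp only [Pi.add_apply, hf u v h, hf' u v h]
    abel
  neg_mem' := by
    rintro f ⟨g, hf⟩
    refine ⟨-g, fun u v h => ?_⟩
    simp only [Pi.neg_apply, hf u v h]
    abel

/-- The first simplicial cohomology group, computed with ordered cochains. -/
abbrev OrderedCohomology : Type _ :=
  orderedCocycles K D ⧸ (orderedCoboundaries K D).addSubgroupOf (orderedCocycles K D)

variable {K D}

theorem apply_self_of_mem_orderedCocycles {c : V → V → D} (hc : c ∈ orderedCocycles K D) {u : V}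
    (hu : {u} ∈ K) : c u u = 0 := by
  simpa using hc u u u (by simpa using hu)

theorem apply_swap_of_mem_orderedCocycles {c : V → V → D}
    (hc : c ∈ orderedCocycles K D) {u v : V} (huv : {u, v} ∈ K) : c v u = -c u v := by
  have huvu := hc u v u (by convert huv using 1; grind)
  rw [apply_self_of_mem_orderedCocycles hc (mem_of_subset huv (by simp) (by simp))] at huvu
  exact eq_neg_of_add_eq_zero_right huvu

end OrderedCochains

section OrientedEdges

variable {V : Type*} [LinearOrder V] {K : PreAbstractSimplicialComplex V}
variable {D : Type*} [AddCommGroup D]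

theorem mem_orderedCocycles_of_lt {c : V → V → D} (self : ∀ u, c u u = 0)
    (swap : ∀ u v, c v u = -c u v)
    (add : ∀ u v w, u < v → v < w → {u, v, w} ∈ K → c u v + c v w = c u w) :
    c ∈ orderedCocycles K D := by
  have of_swap_left {u v w} (h : c v u + c u w = c v w) : c u v + c v w = c u w := by
    rw [← h, swap u v]; abel
  have of_swap_right {u v w} (h : c u w + c w v = c u v) : c u v + c v w = c u w := by
    rw [← h, swap w v]; abel
  intro u v w h
  have swap_left : {v, u, w} ∈ K := by convert h using 1; grind
  have swap_right : {u, w, v} ∈ K := by convert h using 1; grind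
  have rotate : {v, w, u} ∈ K := by convert h using 1; grind
  have rotate' : {w, u, v} ∈ K := by convert h using 1; grind
  have reverse : {w, v, u} ∈ K := by convert h using 1; grind
  rcases lt_trichotomy u v with huv | rfl | huv
  · rcases lt_trichotomy v w with hvw | rfl | hvw
    · exact add u v w huv hvw h
    · rw [self, add_zero]
    · rcases lt_trichotomy u w with huw | rfl | huw
      · exact of_swap_right (add u w v huw hvw swap_right)
      · rw [self, swap u v, add_neg_cancel]
      · exact of_swap_right (of_swap_left (add w u v huw huv rotate'))
  · rw [self, zero_add]
  · rcases lt_trichotomy v w with hvw | rfl | hvw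
    · rcases lt_trichotomy u w with huw | rfl | huw
      · exact of_swap_left (add v u w huv huw swap_left)
      · rw [self, swap v u, neg_add_cancel]
      · exact of_swap_left (of_swap_right (add v w u hvw huw rotate))
    · rw [self, add_zero]
    · exact of_swap_left (of_swap_right (of_swap_left (add w v u hvw huv reverse)))

variable (K) in
/-- The oriented edge from `u` to `v` as a `1`-chain; it vanishes for `u = v`, and when `u` and `v`
do not span an edge. -/
noncomputable def orientedEdge (u v : V) : Simplices K 1 →₀ ℤ :=
  if u < v then elementaryChain K 1 {u, v} else -elementaryChain K 1 {u, v}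

theorem orientedEdge_of_lt {u v : V} (h : u < v) :
    orientedEdge K u v = elementaryChain K 1 {u, v} :=
  if_pos h

theorem orientedEdge_self (u : V) : orientedEdge K u u = 0 := by
  simp [orientedEdge, elementaryChain_eq_zero]

theorem orientedEdge_swap (u v : V) : orientedEdge K v u = -orientedEdge K u v := by
  rcases lt_trichotomy u v with h | rfl | h
  · rw [orientedEdge_of_lt h, orientedEdge, if_neg h.not_gt, Finset.pair_comm]
  · simp [orientedEdge_self]
  · rw [orientedEdge_of_lt h, orientedEdge, if_neg h.not_gt, Finset.pair_comm, neg_neg]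

theorem boundary_orientedEdge {u v : V} (h : {u, v} ∈ K) :
    boundary K 0 (orientedEdge K u v) = elementaryChain K 0 {v} - elementaryChain K 0 {u} := by
  rcases lt_trichotomy u v with huv | rfl | huv
  · rw [orientedEdge_of_lt huv, boundary_pair huv h]
  · rw [orientedEdge_self, map_zero, sub_self]
  · rw [orientedEdge_swap v u, map_neg, orientedEdge_of_lt huv,
      boundary_pair huv (Finset.pair_comm u v ▸ h), neg_sub]

/-- The `1`-cochain with value `c u v` on the edge from `u` to `v` for `u < v`. -/
noncomputable def edgeCochain (K : PreAbstractSimplicialComplex V) (c : V → V → D) :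
    (Simplices K 1 →₀ ℤ) →+ D :=
  chainLift K 1 fun s => ∑ u ∈ s, ∑ v ∈ s with u < v, c u v

theorem edgeCochain_pair (c : V → V → D) {u v : V} (huv : u < v) (hK : {u, v} ∈ K) :
    edgeCochain K c (elementaryChain K 1 {u, v}) = c u v := by
  rw [edgeCochain, chainLift_elementaryChain _ hK (Finset.card_pair huv.ne)]
  simp [Finset.sum_pair huv.ne, Finset.filter_insert, Finset.filter_singleton, huv, huv.not_gt]

theorem edgeCochain_orientedEdge {c : V → V → D} (hc : c ∈ orderedCocycles K D) {u v : V}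
    (h : {u, v} ∈ K) : edgeCochain K c (orientedEdge K u v) = c u v := by
  rcases lt_trichotomy u v with huv | rfl | huv
  · rw [orientedEdge_of_lt huv, edgeCochain_pair c huv h]
  · rw [orientedEdge_self, map_zero, apply_self_of_mem_orderedCocycles hc (by simpa using h)]
  · have h' : {v, u} ∈ K := Finset.pair_comm u v ▸ h
    rw [orientedEdge_swap v u, map_neg, orientedEdge_of_lt huv, edgeCochain_pair c huv h',
      apply_swap_of_mem_orderedCocycles hc h']

theorem edgeCochain_boundary {c : V → V → D} (hc : c ∈ orderedCocycles K D)
    (x : Simplices K 2 →₀ ℤ) : edgeCochain K c (boundary K 1 x) = 0 := by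
  refine DFunLike.congr_fun (f := (edgeCochain K c).comp (boundary K 1)) (g := 0)
    (chain_hom_ext fun s hs hn => ?_) x
  obtain ⟨u, v, w, huv, hvw, rfl⟩ := exists_lt_lt_of_card_eq_three hn
  have edge_mem {a b : V} (hab : ({a, b} : Finset V) ⊆ {u, v, w}) : {a, b} ∈ K :=
    mem_of_subset hs hab (Finset.insert_nonempty a {b})
  rw [AddMonoidHom.comp_apply, boundary_triple huv hvw hs, map_add, map_sub,
    edgeCochain_pair c hvw (edge_mem (by grind)),
    edgeCochain_pair c (huv.trans hvw) (edge_mem (by grind)),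
    edgeCochain_pair c huv (edge_mem (by grind)), ← hc u v w hs]
  simp

theorem mem_cocycles_chains_iff (f : (chains K).X 1 →+ D) :
    f ∈ cocycles (chains K) D 1 ↔ ∀ x, f (boundary K 1 x) = 0 := by
  rw [← chains_d]
  exact DFunLike.ext_iff

theorem mem_coboundaries_chains_iff (f : (chains K).X 1 →+ D) :
    f ∈ coboundaries (chains K) D 1 ↔
      ∃ g : (Simplices K 0 →₀ ℤ) →+ D, ∀ x, g (boundary K 0 x) = f x := by
  rw [← chains_d]
  exact exists_congr fun _ => DFunLike.ext_iff

theorem map_orientedEdge_mem_orderedCocycles {f : (Simplices K 1 →₀ ℤ) →+ D}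
    (hf : ∀ x, f (boundary K 1 x) = 0) :
    (fun u v => f (orientedEdge K u v)) ∈ orderedCocycles K D := by
  refine mem_orderedCocycles_of_lt (fun u => by rw [orientedEdge_self, map_zero])
    (fun u v => by rw [orientedEdge_swap, map_neg]) fun u v w huv hvw h => ?_
  have f_boundary := hf (elementaryChain K 2 {u, v, w})
  rw [boundary_triple huv hvw h, map_add, map_sub] at f_boundary
  rw [orientedEdge_of_lt huv, orientedEdge_of_lt hvw, orientedEdge_of_lt (huv.trans hvw),
    ← sub_eq_zero, ← f_boundary]
  abel

theorem map_orientedEdge_mem_orderedCoboundaries_iff {f : (Simplices K 1 →₀ ℤ) →+ D} :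
    (fun u v => f (orientedEdge K u v)) ∈ orderedCoboundaries K D ↔
      ∃ g : (Simplices K 0 →₀ ℤ) →+ D, ∀ x, g (boundary K 0 x) = f x := by
  constructor
  · rintro ⟨g, hg⟩
    have vertexCochain {v : V} (hv : {v} ∈ K) :
        chainLift K 0 (fun s => ∑ v ∈ s, g v) (elementaryChain K 0 {v}) = g v := by
      rw [chainLift_elementaryChain _ hv (Finset.card_singleton v), Finset.sum_singleton]
    refine ⟨chainLift K 0 fun s => ∑ v ∈ s, g v, DFunLike.congr_fun
      (f := (chainLift K 0 fun s => ∑ v ∈ s, g v).comp (boundary K 0)) <|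
        edge_hom_ext fun u v huv h => ?_⟩
    rw [AddMonoidHom.comp_apply, boundary_pair huv h, map_sub,
      vertexCochain (mem_of_subset h (by simp) (by simp)),
      vertexCochain (mem_of_subset h (by simp) (by simp)), ← orientedEdge_of_lt huv]
    exact (hg u v h).symm
  · rintro ⟨g, hg⟩
    refine ⟨fun v => g (elementaryChain K 0 {v}), fun u v h => ?_⟩
    rw [← map_sub, ← boundary_orientedEdge h, hg]

variable (K D) in
/-- `H¹(K, D)` in terms of ordered cochains. -/
noncomputable def cohomologyEquivOrderedCohomology :
    Cohomology (chains K) D 1 ≃+ OrderedCohomology K D :=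
  let φ : cocycles (chains K) D 1 →+ (V → V → D) :=
    { toFun f u v := f.1 (orientedEdge K u v)
      map_zero' := rfl
      map_add' _ _ := rfl }
  quotientEquivSubquotient φ
    (fun f => map_orientedEdge_mem_orderedCocycles ((mem_cocycles_chains_iff _).mp f.2))
    (fun f => map_orientedEdge_mem_orderedCoboundaries_iff.trans
      (mem_coboundaries_chains_iff f.1).symm)
    fun c hc => by
      let f : cocycles (chains K) D 1 :=
        ⟨edgeCochain K c, (mem_cocycles_chains_iff _).mpr (edgeCochain_boundary hc)⟩
      refine ⟨f, 0, fun u v h => ?_⟩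
      exact (sub_eq_zero.mpr (edgeCochain_orientedEdge hc h)).trans (sub_self 0).symm

end OrientedEdges

section SmallCochains

variable {X D : Type*} [PseudoMetricSpace X] [AddCommGroup D]

/-- The `1`-cochain `f` satisfies the cocycle identity on all triples of points of `S` at mutual
distance less than `ε`. -/
def IsCocycleOn (f : X → X → D) (S : Set X) (ε : ℝ) : Prop :=
  ∀ x ∈ S, ∀ y ∈ S, ∀ z ∈ S, dist x y < ε → dist y z < ε → dist x z < ε → f x y + f y z = f x z

/-- The `1`-cochain `f` is the coboundary of `g` on all pairs of points of `S` at distance less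
than `ε`. -/
def IsPrimitiveOn (g : X → D) (f : X → X → D) (S : Set X) (ε : ℝ) : Prop :=
  ∀ x ∈ S, ∀ y ∈ S, dist x y < ε → f x y = g y - g x

variable {f f' : X → X → D} {g g' : X → D} {S S' : Set X} {ε ε' : ℝ}

theorem IsCocycleOn.mono (hf : IsCocycleOn f S ε) (hS : S' ⊆ S) (hε : ε' ≤ ε) :
    IsCocycleOn f S' ε' :=
  fun x hx y hy z hz hxy hyz hxz => hf x (hS hx) y (hS hy) z (hS hz) (hxy.trans_le hε)
    (hyz.trans_le hε) (hxz.trans_le hε)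

theorem IsCocycleOn.add (hf : IsCocycleOn f S ε) (hf' : IsCocycleOn f' S ε) :
    IsCocycleOn (f + f') S ε := by
  intro x hx y hy z hz hxy hyz hxz
  simp only [Pi.add_apply, ← hf x hx y hy z hz hxy hyz hxz, ← hf' x hx y hy z hz hxy hyz hxz]
  abel

theorem IsCocycleOn.neg (hf : IsCocycleOn f S ε) : IsCocycleOn (-f) S ε := by
  intro x hx y hy z hz hxy hyz hxz
  simp only [Pi.neg_apply, ← hf x hx y hy z hz hxy hyz hxz]
  abel

theorem IsCocycleOn.apply_self (hf : IsCocycleOn f S ε) (hε : 0 < ε) {x : X} (hx : x ∈ S) :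
    f x x = 0 := by
  simpa [hε] using hf x hx x hx x hx

/-- Add up the cocycle identities of the triangles of the ladder between the paths `p` and `q`. -/
theorem IsCocycleOn.sum_add_apply_eq (hf : IsCocycleOn f S ε) {p q : ℕ → X} {n : ℕ}
    (hp : ∀ i ≤ n, p i ∈ S) (hq : ∀ i ≤ n, q i ∈ S)
    (hpp : ∀ i < n, dist (p i) (p (i + 1)) < ε / 2)
    (hqq : ∀ i < n, dist (q i) (q (i + 1)) < ε / 2) (hpq : ∀ i ≤ n, dist (p i) (q i) < ε / 2) :
    ∑ i ∈ Finset.range n, f (p i) (p (i + 1)) + f (p n) (q n) =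
      f (p 0) (q 0) + ∑ i ∈ Finset.range n, f (q i) (q (i + 1)) := by
  induction n with
  | zero => simp
  | succ n ih =>
    have p_step := hpp n n.lt_succ_self
    have q_step := hqq n n.lt_succ_self
    have rung := hpq n n.le_succ
    have rung' := hpq (n + 1) le_rfl
    have diagonal : dist (p n) (q (n + 1)) < ε := by
      linarith [dist_triangle (p n) (q n) (q (n + 1))]
    have upper := hf _ (hp n n.le_succ) _ (hp (n + 1) le_rfl) _ (hq (n + 1) le_rfl)
      (by linarith [dist_nonneg (x := p n) (y := p (n + 1))])
      (by linarith [dist_nonneg (x := p n) (y := p (n + 1))]) diagonal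
    have lower := hf _ (hp n n.le_succ) _ (hq n n.le_succ) _ (hq (n + 1) le_rfl)
      (by linarith [dist_nonneg (x := p n) (y := p (n + 1))])
      (by linarith [dist_nonneg (x := p n) (y := p (n + 1))]) diagonal
    rw [Finset.sum_range_succ, Finset.sum_range_succ, add_assoc, upper, ← lower, ← add_assoc,
      ih (fun i hi => hp i (by lia)) (fun i hi => hq i (by lia)) (fun i hi => hpp i (by lia))
        (fun i hi => hqq i (by lia)) fun i hi => hpq i (by lia), add_assoc]

theorem IsPrimitiveOn.isCocycleOn (hg : IsPrimitiveOn g f S ε) : IsCocycleOn f S ε := by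
  intro x hx y hy z hz hxy hyz hxz
  rw [hg x hx y hy hxy, hg y hy z hz hyz, hg x hx z hz hxz]
  abel

theorem IsPrimitiveOn.mono (hg : IsPrimitiveOn g f S ε) (hS : S' ⊆ S) (hε : ε' ≤ ε) :
    IsPrimitiveOn g f S' ε' :=
  fun x hx y hy hxy => hg x (hS hx) y (hS hy) (hxy.trans_le hε)

theorem IsPrimitiveOn.add (hg : IsPrimitiveOn g f S ε) (hg' : IsPrimitiveOn g' f' S ε) :
    IsPrimitiveOn (g + g') (f + f') S ε := by
  intro x hx y hy hxy
  simp only [Pi.add_apply, hg x hx y hy hxy, hg' x hx y hy hxy]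
  abel

theorem IsPrimitiveOn.neg (hg : IsPrimitiveOn g f S ε) : IsPrimitiveOn (-g) (-f) S ε := by
  intro x hx y hy hxy
  simp only [Pi.neg_apply, hg x hx y hy hxy]
  abel

theorem IsPrimitiveOn.sub_eq_sub (hg : IsPrimitiveOn g f S ε) (hg' : IsPrimitiveOn g' f S ε)
    (hε : 0 < ε) (hS : IsPreconnected S) {x y : X} (hx : x ∈ S) (hy : y ∈ S) :
    g x - g' x = g y - g' y := by
  refine hS.induction₂ (fun x y => g x - g' x = g y - g' y) (fun x hx => ?_)
    (fun x y z _ _ _ hxy hyz => hxy.trans hyz) (fun x y _ _ hxy => hxy.symm) hx hy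
  filter_upwards [self_mem_nhdsWithin, mem_nhdsWithin_of_mem_nhds (Metric.ball_mem_nhds x hε)]
    with y hy hyx
  have hxy : dist x y < ε := by rwa [dist_comm]
  rw [sub_eq_sub_iff_sub_eq_sub, ← neg_sub, ← neg_sub (g' y), ← hg x hx y hy hxy,
    ← hg' x hx y hy hxy]

end SmallCochains

section SmallCohomology

variable {X : Type*} [PseudoMetricSpace X] (S : Set X) (D : Type*) [AddCommGroup D]

/-- Functions of two points of `X` that are cocycles on sufficiently close points of `S`. -/
def smallCocycles : AddSubgroup (X → X → D) where
  carrier := {f | ∃ ε > 0, IsCocycleOn f S ε}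
  zero_mem' := ⟨1, one_pos, fun _ _ _ _ _ _ _ _ _ => add_zero 0⟩
  add_mem' := by
    rintro f f' ⟨ε, hε, hf⟩ ⟨ε', hε', hf'⟩
    exact ⟨min ε ε', lt_min hε hε', (hf.mono subset_rfl (min_le_left _ _)).add
      (hf'.mono subset_rfl (min_le_right _ _))⟩
  neg_mem' := by
    rintro f ⟨ε, hε, hf⟩
    exact ⟨ε, hε, hf.neg⟩

/-- Functions of two points of `X` that are coboundaries on sufficiently close points of `S`. -/
def smallCoboundaries : AddSubgroup (X → X → D) where
  carrier := {f | ∃ g, ∃ ε > 0, IsPrimitiveOn g f S ε}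
  zero_mem' := ⟨0, 1, one_pos, fun _ _ _ _ _ => (sub_zero 0).symm⟩
  add_mem' := by
    rintro f f' ⟨g, ε, hε, hg⟩ ⟨g', ε', hε', hg'⟩
    exact ⟨g + g', min ε ε', lt_min hε hε', (hg.mono subset_rfl (min_le_left _ _)).add
      (hg'.mono subset_rfl (min_le_right _ _))⟩
  neg_mem' := by
    rintro f ⟨g, ε, hε, hg⟩
    exact ⟨-g, ε, hε, hg.neg⟩

/-- The first metric Alexander–Spanier cohomology group of a subset `S` of `X`. Cochains are
defined on all of `X`, but only their values on close points of `S` matter. -/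
abbrev SmallCohomology : Type _ :=
  smallCocycles S D ⧸ (smallCoboundaries S D).addSubgroupOf (smallCocycles S D)

end SmallCohomology

section UniformInvariance

variable {X Y D : Type*} [PseudoMetricSpace X] [PseudoMetricSpace Y] [AddCommGroup D]
variable {S : Set X} {T : Set Y} {φ : X → Y} {ψ : Y → X}

theorem comp_mem_smallCocycles (hφ : UniformContinuousOn φ S) (hST : Set.MapsTo φ S T)
    {f : Y → Y → D} (hf : f ∈ smallCocycles T D) :
    (fun x y => f (φ x) (φ y)) ∈ smallCocycles S D := by
  obtain ⟨ε, hε, hf⟩ := hf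
  obtain ⟨δ, hδ, h⟩ := Metric.uniformContinuousOn_iff.mp hφ ε hε
  exact ⟨δ, hδ, fun x hx y hy z hz hxy hyz hxz => hf _ (hST hx) _ (hST hy) _ (hST hz)
    (h x hx y hy hxy) (h y hy z hz hyz) (h x hx z hz hxz)⟩

theorem comp_mem_smallCoboundaries (hφ : UniformContinuousOn φ S) (hST : Set.MapsTo φ S T)
    {f : Y → Y → D} (hf : f ∈ smallCoboundaries T D) :
    (fun x y => f (φ x) (φ y)) ∈ smallCoboundaries S D := by
  obtain ⟨g, ε, hε, hg⟩ := hf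
  obtain ⟨δ, hδ, h⟩ := Metric.uniformContinuousOn_iff.mp hφ ε hε
  exact ⟨g ∘ φ, δ, hδ, fun x hx y hy hxy => hg _ (hST hx) _ (hST hy) (h x hx y hy hxy)⟩

theorem sub_comp_mem_smallCoboundaries {ρ : X → X} (hρ : Set.EqOn ρ id S) (f : X → X → D) :
    (fun x y => f (ρ x) (ρ y)) - f ∈ smallCoboundaries S D :=
  ⟨0, 1, one_pos, fun x hx y hy _ => by simp [hρ hx, hρ hy]⟩

variable (D) in
/-- Pullback along a uniform equivalence `φ : S → T` with inverse `ψ : T → S`. -/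
noncomputable def smallCohomologyCongr (hφ : UniformContinuousOn φ S)
    (hψ : UniformContinuousOn ψ T) (hST : Set.MapsTo φ S T) (hTS : Set.MapsTo ψ T S)
    (hψφ : Set.LeftInvOn ψ φ S) (hφψ : Set.LeftInvOn φ ψ T) :
    SmallCohomology T D ≃+ SmallCohomology S D := by
  let pullback : (Y → Y → D) →+ (X → X → D) :=
    { toFun f x y := f (φ x) (φ y)
      map_zero' := rfl
      map_add' _ _ := rfl }
  refine quotientEquivSubquotient (pullback.comp (smallCocycles T D).subtype)
    (fun f => comp_mem_smallCocycles hφ hST f.2)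
    (fun f => ⟨fun h => ?_, comp_mem_smallCoboundaries hφ hST⟩)
    fun f hf => ⟨⟨_, comp_mem_smallCocycles hψ hTS hf⟩, sub_comp_mem_smallCoboundaries hψφ f⟩
  change f.1 ∈ smallCoboundaries T D
  rw [← sub_sub_cancel (fun x y => f.1 (φ (ψ x)) (φ (ψ y))) f.1]
  exact sub_mem (comp_mem_smallCoboundaries hψ hTS h) (sub_comp_mem_smallCoboundaries hφψ f.1)

variable (D) in
/-- Pullback along a homeomorphism between compact spaces, which is a uniform equivalence. -/
noncomputable def smallCohomologyEquivOfHomeomorph [CompactSpace Y] [Nonempty Y] (e : S ≃ₜ Y) :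
    SmallCohomology (Set.univ : Set Y) D ≃+ SmallCohomology S D := by
  have : CompactSpace S := e.symm.compactSpace
  let φ : X → Y := Function.extend Subtype.val e fun _ => Classical.arbitrary Y
  have φ_apply (x : S) : φ x = e x := Subtype.val_injective.extend_apply _ _ _
  refine smallCohomologyCongr D (φ := φ) (ψ := fun y => (e.symm y).1) ?_ ?_ (Set.mapsTo_univ _ _)
    (fun y _ => (e.symm y).2) (fun x hx => ?_) (fun y _ => ?_)
  · rw [uniformContinuousOn_iff_restrict]
    convert CompactSpace.uniformContinuous_of_continuous e.continuous using 1
    exact funext φ_apply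
  · exact (uniformContinuous_subtype_val.comp
      (CompactSpace.uniformContinuous_of_continuous e.symm.continuous)).uniformContinuousOn
  · change (e.symm (φ x)).1 = x
    rw [φ_apply ⟨x, hx⟩, e.symm_apply_apply]
  · rw [φ_apply, e.apply_symm_apply]

end UniformInvariance

section StarConvex

variable {E D : Type*} [SeminormedAddCommGroup E] [NormedSpace ℝ E] [AddCommGroup D]
variable {f : E → E → D} {S : Set E} {o : E} {ε : ℝ}

theorem dist_add_smul_sub_le (x y : E) {t : ℝ} (h0 : 0 ≤ t) (h1 : t ≤ 1) :
    dist (o + t • (x - o)) (o + t • (y - o)) ≤ dist x y := by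
  rw [dist_add_left, dist_smul₀, dist_sub_right, Real.norm_of_nonneg h0]
  exact mul_le_of_le_one_left dist_nonneg h1

theorem IsCocycleOn.exists_isPrimitiveOn_of_isBounded (hf : IsCocycleOn f S ε) (hε : 0 < ε)
    (hS : StarConvex ℝ o S) (ho : o ∈ S) (hb : Bornology.IsBounded S) :
    ∃ g, g o = 0 ∧ IsPrimitiveOn g f S (ε / 2) := by
  obtain ⟨R, hR⟩ := hb.subset_closedBall o
  obtain ⟨n, hn⟩ := exists_nat_gt (max 0 (R / (ε / 2)))
  obtain ⟨hn0, hnR⟩ := max_lt_iff.mp hn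
  -- The primitive sums `f` along the segment from `o` to `x`, cut into `n` steps of equal length.
  let h (i : ℕ) (x : E) : E := o + (i / n : ℝ) • (x - o)
  have frac_le_one {i : ℕ} (hi : i ≤ n) : (i / n : ℝ) ≤ 1 :=
    div_le_one_of_le₀ (by exact_mod_cast hi) hn0.le
  have mem {i : ℕ} (hi : i ≤ n) {x : E} (hx : x ∈ S) : h i x ∈ S :=
    hS.add_smul_sub_mem hx (by positivity) (frac_le_one hi)
  have rung {i : ℕ} (hi : i ≤ n) (x y : E) : dist (h i x) (h i y) ≤ dist x y :=
    dist_add_smul_sub_le x y (by positivity) (frac_le_one hi)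
  have step (i : ℕ) {x : E} (hx : x ∈ S) : dist (h i x) (h (i + 1) x) < ε / 2 := by
    have hxR : ‖x - o‖ ≤ R := by simpa [dist_eq_norm] using hR hx
    have : dist (h i x) (h (i + 1) x) = ‖x - o‖ / n := by
      simp only [h]
      rw [dist_add_left, dist_eq_norm, ← sub_smul, norm_smul, ← sub_div]
      simp [div_eq_inv_mul]
    rw [this, div_lt_iff₀ hn0]
    exact hxR.trans_lt (by rwa [div_lt_iff₀' (half_pos hε)] at hnR)
  have h_zero (x : E) : h 0 x = o := by simp [h]
  have h_last (x : E) : h n x = x := by simp [h, hn0.ne']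
  have h_center (i : ℕ) : h i o = o := by simp [h]
  refine ⟨fun x => ∑ i ∈ Finset.range n, f (h i x) (h (i + 1) x), ?_, fun x hx y hy hxy => ?_⟩
  · simp [h_center, hf.apply_self hε ho]
  · have ladder := hf.sum_add_apply_eq (fun i hi => mem hi hx) (fun i hi => mem hi hy)
      (fun i _ => step i hx) (fun i _ => step i hy) fun i hi => (rung hi x y).trans_lt hxy
    rw [h_zero, h_zero, h_last, h_last, hf.apply_self hε ho, zero_add] at ladder
    exact eq_sub_of_add_eq' ladder

theorem IsCocycleOn.exists_isPrimitiveOn (hf : IsCocycleOn f S ε) (hε : 0 < ε)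
    (hS : StarConvex ℝ o S) (ho : o ∈ S) : ∃ g, IsPrimitiveOn g f S (ε / 2) := by
  let B (n : ℕ) : Set E := S ∩ Metric.closedBall o n
  have B_mono : Monotone B := fun m n hmn =>
    Set.inter_subset_inter_right S (Metric.closedBall_subset_closedBall (by exact_mod_cast hmn))
  have center_mem (n : ℕ) : o ∈ B n := ⟨ho, Metric.mem_closedBall_self n.cast_nonneg⟩
  have B_starConvex (n : ℕ) : StarConvex ℝ o (B n) :=
    hS.inter ((convex_closedBall o n).starConvex (center_mem n).2)
  have exists_on (n : ℕ) := (hf.mono Set.inter_subset_left le_rfl).exists_isPrimitiveOn_of_isBounded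
    hε (B_starConvex n) (center_mem n) (Metric.isBounded_closedBall.subset Set.inter_subset_right)
  choose g g_center hg using exists_on
  have g_eq {m n : ℕ} (hmn : m ≤ n) {x : E} (hx : x ∈ B m) : g n x = g m x := by
    have := ((hg n).mono (B_mono hmn) le_rfl).sub_eq_sub (hg m) (half_pos hε)
      ((B_starConvex m).isPathConnected (center_mem m)).isConnected.isPreconnected hx (center_mem m)
    rwa [g_center, g_center, sub_self, sub_eq_zero] at this
  have mem_B {x : E} (hx : x ∈ S) : x ∈ B ⌈dist x o⌉₊ := ⟨hx, Nat.le_ceil (dist x o)⟩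
  refine ⟨fun x => g ⌈dist x o⌉₊ x, fun x hx y hy hxy => ?_⟩
  change f x y = g _ y - g _ x
  rw [← g_eq (le_max_left _ ⌈dist y o⌉₊) (mem_B hx), ← g_eq (le_max_right ⌈dist x o⌉₊ _) (mem_B hy)]
  exact hg _ x (B_mono (le_max_left _ _) (mem_B hx)) y (B_mono (le_max_right _ _) (mem_B hy)) hxy

end StarConvex

section Realization

variable {V : Type*} [Fintype V]

/-- The carrier of a point of the realization: the vertices with nonzero barycentric coordinate. -/
noncomputable def carrier (x : V → ℝ) : Finset V := {v | x v ≠ 0}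

theorem mem_carrier {x : V → ℝ} {v : V} : v ∈ carrier x ↔ x v ≠ 0 := by simp [carrier]

theorem mem_stdSimplex_of_mem_realization {A : PreAbstractSimplicialComplex V} {x : V → ℝ}
    (hx : x ∈ realization A) : x ∈ stdSimplex ℝ V :=
  ⟨hx.1, hx.2.1⟩

theorem carrier_nonempty {x : V → ℝ} (hx : x ∈ stdSimplex ℝ V) : (carrier x).Nonempty := by
  obtain ⟨v, -, hv⟩ := Finset.exists_ne_zero_of_sum_ne_zero (hx.2.trans_ne one_ne_zero)
  exact ⟨v, mem_carrier.mpr hv⟩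

theorem carrier_mem {A : PreAbstractSimplicialComplex V} {x : V → ℝ} (hx : x ∈ realization A) :
    carrier x ∈ A := by
  obtain ⟨s, hs, hxs⟩ := hx.2.2
  refine mem_of_subset hs (fun v hv => ?_)
    (carrier_nonempty (mem_stdSimplex_of_mem_realization hx))
  contrapose! hv
  simp [mem_carrier, hxs v hv]

theorem carrier_single [DecidableEq V] (u : V) : carrier (Pi.single u 1 : V → ℝ) = {u} := by
  ext v
  by_cases h : v = u <;> simp [mem_carrier, h]

/-- A vertex at which the barycentric coordinate of `x` is maximal. -/
noncomputable def topVertex [Nonempty V] (x : V → ℝ) : V := (Finite.exists_max x).choose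

theorem le_apply_topVertex [Nonempty V] (x : V → ℝ) (v : V) : x v ≤ x (topVertex x) :=
  (Finite.exists_max x).choose_spec v

variable (V) in
/-- Some barycentric coordinate of every point is at least this large. -/
noncomputable def topScale : ℝ := (Fintype.card V : ℝ)⁻¹

theorem topScale_pos [Nonempty V] : 0 < topScale V :=
  inv_pos.mpr (by exact_mod_cast Fintype.card_pos)

theorem topVertex_mem_carrier [Nonempty V] {x y : V → ℝ} (hx : x ∈ stdSimplex ℝ V)
    (hxy : dist x y < topScale V) : topVertex x ∈ carrier y := by
  have one_le : 1 ≤ Fintype.card V * x (topVertex x) := by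
    simpa [hx.2] using Finset.sum_le_card_nsmul Finset.univ x _ fun v _ => le_apply_topVertex x v
  have scale_le : topScale V ≤ x (topVertex x) :=
    (inv_le_iff_one_le_mul₀' (by exact_mod_cast Fintype.card_pos)).mpr one_le
  have dist_le := (dist_le_pi_dist x y (topVertex x)).trans_lt hxy
  rw [mem_carrier]
  intro h0
  rw [h0, Real.dist_0_eq_abs] at dist_le
  exact ((le_abs_self _).trans_lt dist_le).not_ge scale_le

theorem topVertex_mem_carrier_self [Nonempty V] {x : V → ℝ} (hx : x ∈ stdSimplex ℝ V) :
    topVertex x ∈ carrier x :=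
  topVertex_mem_carrier hx (by rw [dist_self]; exact topScale_pos)

theorem pair_topVertex_subset_carrier [Nonempty V] [DecidableEq V] {x y : V → ℝ}
    (hx : x ∈ stdSimplex ℝ V) (hy : y ∈ stdSimplex ℝ V) (hxy : dist x y < topScale V) :
    {topVertex x, topVertex y} ⊆ carrier x :=
  Finset.insert_subset (topVertex_mem_carrier_self hx)
    (Finset.singleton_subset_iff.mpr (topVertex_mem_carrier hy (by rwa [dist_comm])))

theorem topVertex_single [Nonempty V] [DecidableEq V] (u : V) :
    topVertex (Pi.single u 1 : V → ℝ) = u := by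
  have := topVertex_mem_carrier_self (single_mem_stdSimplex ℝ u)
  rwa [carrier_single, Finset.mem_singleton] at this

end Realization

section ClosedStar

variable {V : Type*} [Fintype V] [DecidableEq V] {A : PreAbstractSimplicialComplex V}
variable {s t : Finset V} {x y : V → ℝ}

variable (A) in
/-- The closed star in `|A|` of a set `s` of vertices. For `s = ∅` it is all of `|A|`. -/
def closedStar (s : Finset V) : Set (V → ℝ) := {x ∈ stdSimplex ℝ V | s ∪ carrier x ∈ A}

theorem closedStar_anti (hst : s ⊆ t) : closedStar A t ⊆ closedStar A s :=
  fun _ hx => ⟨hx.1, mem_of_subset hx.2 (Finset.union_subset_union_left hst)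
    ((carrier_nonempty hx.1).mono Finset.subset_union_right)⟩

theorem mem_closedStar_of_subset_carrier (hx : x ∈ realization A) (hs : s ⊆ carrier x) :
    x ∈ closedStar A s :=
  ⟨mem_stdSimplex_of_mem_realization hx, (Finset.union_eq_right.mpr hs).symm ▸ carrier_mem hx⟩

theorem closedStar_subset_realization : closedStar A s ⊆ realization A := by
  intro x hx
  obtain ⟨⟨h0, h1⟩, h⟩ := closedStar_anti (Finset.empty_subset s) hx
  rw [Finset.empty_union] at h
  exact ⟨h0, h1, _, h, fun v hv => by simpa [mem_carrier] using hv⟩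

theorem single_mem_closedStar {u : V} (hu : s ∪ {u} ∈ A) : Pi.single u 1 ∈ closedStar A s :=
  ⟨single_mem_stdSimplex ℝ u, by rwa [carrier_single]⟩

theorem mem_of_closedStar_nonempty (h : (closedStar A s).Nonempty) (hts : t ⊆ s)
    (ht : t.Nonempty) : t ∈ A :=
  mem_of_subset h.some_mem.2 (hts.trans Finset.subset_union_left) ht

theorem starConvex_closedStar {u : V} (hu : u ∈ s) :
    StarConvex ℝ (Pi.single u 1) (closedStar A s) := by
  intro x hx a b ha hb hab
  refine ⟨convex_stdSimplex ℝ V (single_mem_stdSimplex ℝ u) hx.1 ha hb hab,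
    mem_of_subset hx.2 (Finset.union_subset Finset.subset_union_left fun v hv => ?_)
      ⟨u, Finset.mem_union_left _ hu⟩⟩
  rw [Finset.mem_union, or_iff_not_imp_left, mem_carrier]
  intro hvs hxv
  have hvu : v ≠ u := by rintro rfl; exact hvs hu
  simp [mem_carrier, hvu, hxv] at hv

theorem isPreconnected_closedStar (hs : s.Nonempty) : _root_.IsPreconnected (closedStar A s) := by
  obtain h | h := (closedStar A s).eq_empty_or_nonempty
  · exact h ▸ isPreconnected_empty
  · obtain ⟨u, hu⟩ := hs
    have center_mem := single_mem_closedStar (u := u) (s := s)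
      (by simpa [hu] using mem_of_closedStar_nonempty h subset_rfl ⟨u, hu⟩)
    exact ((starConvex_closedStar hu).isPathConnected center_mem).isConnected.isPreconnected

end ClosedStar

section Comparison

variable {V : Type*} [Fintype V] [DecidableEq V] [Nonempty V]
variable {A : PreAbstractSimplicialComplex V} {D : Type*} [AddCommGroup D] {c : V → V → D}

variable (V D) in
/-- The `1`-cochain on points of the realization induced by a `1`-cochain on vertices. -/
noncomputable def topCochain : (V → V → D) →+ ((V → ℝ) → (V → ℝ) → D) where
  toFun c x y := c (topVertex x) (topVertex y)
  map_zero' := rfl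
  map_add' _ _ := rfl

theorem topCochain_mem_smallCocycles (hc : c ∈ orderedCocycles A D) :
    topCochain V D c ∈ smallCocycles (realization A) D := by
  refine ⟨topScale V, topScale_pos, fun x hx y hy z hz hxy _ hxz =>
    hc _ _ _ (mem_of_subset (carrier_mem hx) ?_ (by simp))⟩
  replace hx := mem_stdSimplex_of_mem_realization hx
  have hxy := pair_topVertex_subset_carrier hx (mem_stdSimplex_of_mem_realization hy) hxy
  have hxz := pair_topVertex_subset_carrier hx (mem_stdSimplex_of_mem_realization hz) hxz
  grind

theorem topCochain_mem_smallCoboundaries (hc : c ∈ orderedCoboundaries A D) :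
    topCochain V D c ∈ smallCoboundaries (realization A) D := by
  obtain ⟨g, hg⟩ := hc
  exact ⟨fun x => g (topVertex x), topScale V, topScale_pos, fun x hx y hy hxy => hg _ _
    (mem_of_subset (carrier_mem hx) (pair_topVertex_subset_carrier
      (mem_stdSimplex_of_mem_realization hx) (mem_stdSimplex_of_mem_realization hy) hxy) (by simp))⟩

theorem isPrimitiveOn_topCochain (hc : c ∈ orderedCocycles A D) (u : V) :
    IsPrimitiveOn (fun x => c u (topVertex x)) (topCochain V D c) (closedStar A {u})
      (topScale V) :=
  fun x hx y hy hxy => eq_sub_of_add_eq' (hc _ _ _ (mem_of_subset hx.2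
    (Finset.insert_subset_insert u (pair_topVertex_subset_carrier hx.1 hy.1 hxy)) (by simp)))

theorem mem_orderedCoboundaries_of_topCochain_mem (hc : c ∈ orderedCocycles A D)
    (h : topCochain V D c ∈ smallCoboundaries (realization A) D) :
    c ∈ orderedCoboundaries A D := by
  obtain ⟨g, ε, hε, hg⟩ := h
  refine ⟨fun u => g (Pi.single u 1), fun u w huw => ?_⟩
  have hu : {u} ∈ A := mem_of_subset huw (by simp) (by simp)
  have sub_eq_sub := ((isPrimitiveOn_topCochain hc u).mono subset_rfl (min_le_right ε _)).sub_eq_sub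
    (hg.mono closedStar_subset_realization (min_le_left _ (topScale V)))
    (lt_min hε topScale_pos) (isPreconnected_closedStar (Finset.singleton_nonempty u))
    (single_mem_closedStar (u := u) (by simpa using hu)) (single_mem_closedStar huw)
  rw [topVertex_single, topVertex_single, apply_self_of_mem_orderedCocycles hc hu, zero_sub]
    at sub_eq_sub
  rw [← neg_add_eq_sub, sub_eq_sub]
  abel

/-- Primitives on the stars of the vertices differ by constants on the stars of the edges, and
these constants form a simplicial cocycle. -/
theorem exists_topCochain_sub_mem_smallCoboundaries {f : (V → ℝ) → (V → ℝ) → D}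
    (hf : f ∈ smallCocycles (realization A) D) :
    ∃ c ∈ orderedCocycles A D, topCochain V D c - f ∈ smallCoboundaries (realization A) D := by
  obtain ⟨ε, hε, hf⟩ := hf
  have exists_on (u : V) : ∃ g, IsPrimitiveOn g f (closedStar A {u}) (ε / 2) := by
    by_cases hu : {u} ∈ A
    · exact (hf.mono closedStar_subset_realization le_rfl).exists_isPrimitiveOn hε
        (starConvex_closedStar (Finset.mem_singleton_self u)) (single_mem_closedStar (by simpa))
    · exact ⟨0, fun x hx => absurd (mem_of_closedStar_nonempty ⟨x, hx⟩ subset_rfl (by simp)) hu⟩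
  choose g hg using exists_on
  let c (u v : V) : D := g u (Pi.single v 1) - g v (Pi.single v 1)
  have c_eq {u v : V} {x : V → ℝ} (hx : x ∈ closedStar A {u, v}) : c u v = g u x - g v x :=
    ((hg u).mono (closedStar_anti (by simp)) le_rfl).sub_eq_sub
      ((hg v).mono (closedStar_anti (by simp)) le_rfl) (half_pos hε)
      (isPreconnected_closedStar (by simp))
      (single_mem_closedStar (mem_of_closedStar_nonempty ⟨x, hx⟩ (by simp) (by simp))) hx
  refine ⟨c, fun u v w huvw => ?_, fun x => -g (topVertex x) x, min (ε / 2) (topScale V),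
    lt_min (half_pos hε) topScale_pos, fun x hx y hy hxy => ?_⟩
  · rw [c_eq (single_mem_closedStar (u := w) (by simpa using huvw))]
    exact sub_add_sub_cancel _ _ _
  · obtain ⟨hxyε, hxy⟩ := lt_min_iff.mp hxy
    have hxΔ := mem_stdSimplex_of_mem_realization hx
    have hyΔ := mem_stdSimplex_of_mem_realization hy
    have hx' : x ∈ closedStar A {topVertex x} := mem_closedStar_of_subset_carrier hx
      (Finset.singleton_subset_iff.mpr (topVertex_mem_carrier_self hxΔ))
    have hy' : y ∈ closedStar A {topVertex x, topVertex y} := mem_closedStar_of_subset_carrier hy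
      (Finset.insert_subset (topVertex_mem_carrier hxΔ hxy)
        (Finset.singleton_subset_iff.mpr (topVertex_mem_carrier_self hyΔ)))
    change c (topVertex x) (topVertex y) - f x y = -g (topVertex y) y - -g (topVertex x) x
    rw [c_eq hy', hg _ x hx' y (closedStar_anti (by simp) hy') hxyε]
    abel

variable (A D) in
/-- Simplicial and metric cohomology of the realization agree in degree one. -/
noncomputable def orderedCohomologyEquivSmallCohomology :
    OrderedCohomology A D ≃+ SmallCohomology (realization A) D :=
  quotientEquivSubquotient ((topCochain V D).comp (orderedCocycles A D).subtype)
    (fun c => topCochain_mem_smallCocycles c.2)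
    (fun c => ⟨mem_orderedCoboundaries_of_topCochain_mem c.2, topCochain_mem_smallCoboundaries⟩)
    fun _ hf => by
      obtain ⟨c, hc, h⟩ := exists_topCochain_sub_mem_smallCoboundaries hf
      exact ⟨⟨c, hc⟩, h⟩

end Comparison

section Circle

/-- The representative in `[0, 1)` of a point of the circle. -/
noncomputable def circleLift (p : UnitAddCircle) : ℝ := AddCircle.equivIco 1 0 p

theorem circleLift_coe (x : ℝ) : circleLift x = Int.fract x := by
  simp [circleLift, AddCircle.coe_equivIco_mk_apply]

/-- The winding cocycle on the circle: the signed number of times that the short arc from `p` to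
`q` crosses `0`. -/
noncomputable def winding (p q : UnitAddCircle) : ℤ := round (circleLift p - circleLift q)

theorem winding_coe {x y : ℝ} (h : |x - y| < 1 / 2) : winding x y = ⌊y⌋ - ⌊x⌋ := by
  have round_sub : round (x - y) = 0 := by
    obtain ⟨lower, upper⟩ := abs_lt.mp h
    exact round_eq_zero_iff.mpr ⟨by linarith, by linarith⟩
  have fract_sub : Int.fract x - Int.fract y = x - y + ((⌊y⌋ - ⌊x⌋ : ℤ) : ℝ) := by
    rw [Int.fract, Int.fract]
    push_cast
    ring
  rw [winding, circleLift_coe, circleLift_coe, fract_sub, round_add_intCast, round_sub, zero_add]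

theorem exists_coe_eq_and_dist_eq (x : ℝ) (q : UnitAddCircle) :
    ∃ y : ℝ, (y : UnitAddCircle) = q ∧ dist x y = dist (x : UnitAddCircle) q := by
  obtain ⟨y, rfl⟩ := QuotientAddGroup.mk_surjective q
  refine ⟨y + round (x - y), ?_, ?_⟩
  · simp
  · have := UnitAddCircle.norm_eq (x := x - y)
    rw [AddCircle.coe_sub] at this
    rw [dist_eq_norm (x : UnitAddCircle), Real.dist_eq, ← sub_sub]
    exact this.symm

end Circle

section Torus

variable {ι : Type*}

/-- The covering of the torus by Euclidean space. -/
def torusProj (x : ι → ℝ) : UnitAddTorus ι := fun i => (x i : UnitAddCircle)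

theorem torusProj_surjective : Function.Surjective (torusProj (ι := ι)) :=
  Function.Surjective.piMap fun _ => QuotientAddGroup.mk_surjective

theorem torusProj_add_single [DecidableEq ι] (x : ι → ℝ) (j : ι) :
    torusProj (x + Pi.single j 1) = torusProj x := by
  ext i
  obtain rfl | h := eq_or_ne i j <;> simp [torusProj, *]

theorem eq_of_torusProj_eq [Finite ι] [DecidableEq ι] {α : Type*} {g : (ι → ℝ) → α}
    (hg : ∀ j, Function.Periodic g (Pi.single j 1)) {x y : ι → ℝ} (h : torusProj x = torusProj y) :
    g x = g y := by
  cases nonempty_fintype ι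
  have exists_int (i : ι) : ∃ n : ℤ, n • (1 : ℝ) = y i - x i := by
    rw [← AddCircle.coe_eq_zero_iff, AddCircle.coe_sub, sub_eq_zero]
    exact (congrFun h i).symm
  choose n hn using exists_int
  have periodic_sum (s : Finset ι) : Function.Periodic g (∑ j ∈ s, n j • Pi.single j (1 : ℝ)) := by
    induction s using Finset.induction_on with
    | empty => exact fun x => by simp
    | insert j s hj ih =>
      rw [Finset.sum_insert hj]
      exact ((hg j).zsmul (n j)).add_period ih
  rw [← periodic_sum Finset.univ x]
  congr 1
  ext i
  simpa [Finset.sum_apply, Pi.single_apply, eq_sub_iff_add_eq'] using hn i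

variable [Fintype ι]

theorem dist_torusProj_le (x y : ι → ℝ) : dist (torusProj x) (torusProj y) ≤ dist x y := by
  refine dist_pi_le_iff dist_nonneg |>.mpr fun i => le_trans ?_ (dist_le_pi_dist x y i)
  rw [dist_eq_norm, dist_eq_norm, torusProj, torusProj, ← AddCircle.coe_sub]
  exact QuotientAddGroup.norm_mk_le_norm

theorem exists_torusProj_eq_and_dist_le (x : ι → ℝ) (q : UnitAddTorus ι) :
    ∃ y, torusProj y = q ∧ dist x y ≤ dist (torusProj x) q := by
  choose y hy hxy using fun i => exists_coe_eq_and_dist_eq (x i) (q i)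
  exact ⟨y, funext hy, dist_pi_le_iff dist_nonneg |>.mpr fun i =>
    (hxy i).trans_le (dist_le_pi_dist (torusProj x) q i)⟩

end Torus

section TorusCohomology

variable {ι : Type*} [Fintype ι] {D : Type*} [AddCommGroup D]

variable {f : UnitAddTorus ι → UnitAddTorus ι → D} {ε : ℝ}

theorem IsCocycleOn.comp_torusProj (hf : IsCocycleOn f Set.univ ε) :
    IsCocycleOn (fun x y => f (torusProj x) (torusProj y)) Set.univ ε :=
  fun x _ y _ z _ hxy hyz hxz => hf _ trivial _ trivial _ trivial
    ((dist_torusProj_le x y).trans_lt hxy) ((dist_torusProj_le y z).trans_lt hyz)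
    ((dist_torusProj_le x z).trans_lt hxz)

theorem IsCocycleOn.of_comp_torusProj
    (hf : IsCocycleOn (fun x y => f (torusProj x) (torusProj y)) Set.univ ε) :
    IsCocycleOn f Set.univ (ε / 2) := by
  intro p _ q _ r _ hpq hqr hpr
  obtain ⟨x, rfl⟩ := torusProj_surjective p
  obtain ⟨y, rfl, hxy⟩ := exists_torusProj_eq_and_dist_le x q
  obtain ⟨z, rfl, hxz⟩ := exists_torusProj_eq_and_dist_le x r
  have hyz := dist_triangle_left y z x
  have := dist_nonneg (x := x) (y := y)
  exact hf x trivial y trivial z trivial (by linarith) (by linarith) (by linarith)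

theorem IsPrimitiveOn.comp_torusProj {g : UnitAddTorus ι → D} (hg : IsPrimitiveOn g f Set.univ ε) :
    IsPrimitiveOn (g ∘ torusProj) (fun x y => f (torusProj x) (torusProj y)) Set.univ ε :=
  fun x _ y _ hxy => hg _ trivial _ trivial ((dist_torusProj_le x y).trans_lt hxy)

theorem IsPrimitiveOn.of_comp_torusProj {g : UnitAddTorus ι → D}
    (hg : IsPrimitiveOn (g ∘ torusProj) (fun x y => f (torusProj x) (torusProj y)) Set.univ ε) :
    IsPrimitiveOn g f Set.univ ε := by
  intro p _ q _ hpq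
  obtain ⟨x, rfl⟩ := torusProj_surjective p
  obtain ⟨y, rfl, hxy⟩ := exists_torusProj_eq_and_dist_le x q
  exact hg x trivial y trivial (hxy.trans_lt hpq)

variable (ι D) in
/-- The cocycle on the torus with prescribed periods. -/
noncomputable def torusCocycle : (ι → D) →+ (UnitAddTorus ι → UnitAddTorus ι → D) where
  toFun m p q := ∑ i, winding (p i) (q i) • m i
  map_zero' := by
    ext p q
    simp
  map_add' m m' := by
    ext p q
    simp [Finset.sum_add_distrib]

theorem isPrimitiveOn_torusCocycle_comp_torusProj (m : ι → D) :
    IsPrimitiveOn (fun x => ∑ i, ⌊x i⌋ • m i)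
      (fun x y => torusCocycle ι D m (torusProj x) (torusProj y)) Set.univ (1 / 2) := by
  intro x _ y _ hxy
  simp only [← Finset.sum_sub_distrib, ← sub_smul]
  refine Finset.sum_congr rfl fun i _ => ?_
  rw [torusProj, torusProj, winding_coe ((dist_le_pi_dist x y i).trans_lt hxy)]

theorem torusCocycle_mem_smallCocycles (m : ι → D) :
    torusCocycle ι D m ∈ smallCocycles (Set.univ : Set (UnitAddTorus ι)) D :=
  ⟨1 / 2 / 2, by norm_num,
    (isPrimitiveOn_torusCocycle_comp_torusProj m).isCocycleOn.of_comp_torusProj⟩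

theorem sum_floor_add_single [DecidableEq ι] (m : ι → D) (x : ι → ℝ) (j : ι) :
    ∑ i, ⌊(x + Pi.single j 1 : ι → ℝ) i⌋ • m i = ∑ i, ⌊x i⌋ • m i + m j := by
  have floor_eq (i : ι) : ⌊(x + Pi.single j 1 : ι → ℝ) i⌋ = ⌊x i⌋ + (Pi.single j 1 : ι → ℤ) i := by
    obtain rfl | h := eq_or_ne i j <;> simp [*]
  simp only [floor_eq, add_smul, Finset.sum_add_distrib]
  simp [Pi.single_apply, ite_smul]

theorem eq_zero_of_torusCocycle_mem_smallCoboundaries {m : ι → D}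
    (h : torusCocycle ι D m ∈ smallCoboundaries (Set.univ : Set (UnitAddTorus ι)) D) : m = 0 := by
  classical
  obtain ⟨g, ε, hε, hg⟩ := h
  ext j
  have sub_eq_sub := ((isPrimitiveOn_torusCocycle_comp_torusProj m).mono subset_rfl
      (min_le_right ε _)).sub_eq_sub (hg.comp_torusProj.mono subset_rfl (min_le_left _ (1 / 2)))
    (lt_min hε (by norm_num)) isPreconnected_univ (Set.mem_univ (0 + Pi.single j 1))
    (Set.mem_univ 0)
  simpa only [sum_floor_add_single, Function.comp_apply, torusProj_add_single, sub_left_inj,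
    add_eq_left, Pi.zero_apply] using sub_eq_sub

theorem exists_torusCocycle_sub_mem_smallCoboundaries
    (hf : f ∈ smallCocycles (Set.univ : Set (UnitAddTorus ι)) D) :
    ∃ m, torusCocycle ι D m - f ∈ smallCoboundaries (Set.univ : Set (UnitAddTorus ι)) D := by
  classical
  obtain ⟨ε, hε, hf⟩ := hf
  obtain ⟨g, hg⟩ := hf.comp_torusProj.exists_isPrimitiveOn hε (starConvex_univ 0) (Set.mem_univ 0)
  have translate (j : ι) : IsPrimitiveOn (fun x => g (x + Pi.single j 1))
      (fun x y => f (torusProj x) (torusProj y)) Set.univ (ε / 2) := by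
    intro x _ y _ hxy
    have := hg (x + Pi.single j 1) trivial (y + Pi.single j 1) trivial (by simpa using hxy)
    simpa only [torusProj_add_single] using this
  let m (j : ι) : D := g (0 + Pi.single j 1) - g 0
  have period (j : ι) (x : ι → ℝ) : g (x + Pi.single j 1) - g x = m j :=
    (translate j).sub_eq_sub hg (half_pos hε) isPreconnected_univ trivial trivial
  let g' (x : ι → ℝ) : D := ∑ i, ⌊x i⌋ • m i - g x
  have g'_periodic (j : ι) : Function.Periodic g' (Pi.single j 1) := by
    intro x
    simp only [g', sum_floor_add_single, ← period j x]
    abel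
  let G (p : UnitAddTorus ι) : D := g' (Function.surjInv torusProj_surjective p)
  have G_torusProj (x : ι → ℝ) : G (torusProj x) = g' x :=
    eq_of_torusProj_eq g'_periodic (Function.surjInv_eq _ _)
  refine ⟨m, G, min (ε / 2) (1 / 2), lt_min (half_pos hε) (by norm_num),
    IsPrimitiveOn.of_comp_torusProj ?_⟩
  rw [show G ∘ torusProj = g' from funext G_torusProj]
  have := ((isPrimitiveOn_torusCocycle_comp_torusProj m).mono subset_rfl (min_le_right _ _)).add
    (hg.mono subset_rfl (min_le_left _ _)).neg
  rw [← sub_eq_add_neg, ← sub_eq_add_neg] at this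
  exact this

variable (ι D) in
/-- The periods of a cocycle on the torus determine its cohomology class. -/
noncomputable def smallCohomologyTorusEquiv :
    (ι → D) ≃+ SmallCohomology (Set.univ : Set (UnitAddTorus ι)) D :=
  QuotientAddGroup.quotientBot.symm.trans <|
    quotientEquivSubquotient (torusCocycle ι D) torusCocycle_mem_smallCocycles
      (fun m => ⟨fun h => AddSubgroup.mem_bot.mpr (eq_zero_of_torusCocycle_mem_smallCoboundaries h),
        fun h => by simp [AddSubgroup.mem_bot.mp h]⟩)
      fun _ hf => exists_torusCocycle_sub_mem_smallCoboundaries hf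

end TorusCohomology

section RegionHomeomorphicToTorus

variable {V : Type v} [Fintype V] [LinearOrder V] {A : PreAbstractSimplicialComplex V}
variable {ι : Type*} [Fintype ι]

/-- The periods of a homomorphism on the first homology of a triangulated torus. -/
noncomputable def homologyOneDualTorusEquiv (e : realization A ≃ₜ UnitAddTorus ι)
    (D : Type u) [AddCommGroup D] : ((chains A).homology 1 →+ D) ≃+ (ι → D) :=
  have : Nonempty V := by
    obtain ⟨x, -, hx, -⟩ := e.symm 0
    exact (Finset.univ_nonempty_iff.mp (Finset.nonempty_of_sum_ne_zero (hx.trans_ne one_ne_zero)))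
  (cohomologyOneEquiv A D).symm.trans <|
    (cohomologyEquivOrderedCohomology A D).trans <|
    (orderedCohomologyEquivSmallCohomology A D).trans <|
    (smallCohomologyEquivOfHomeomorph D e).symm.trans (smallCohomologyTorusEquiv ι D).symm

theorem betti_one_of_homeomorph_torus (e : realization A ≃ₜ UnitAddTorus ι) :
    betti (chains A) 1 = Fintype.card ι := by
  let periods := homologyOneDualTorusEquiv e ℚ
  let linearPeriods : ((chains A).homology 1 →+ ℚ) ≃ₗ[ℚ] (ι → ℚ) :=
    { periods with map_smul' := map_rat_smul periods }
  rw [betti, ← finrank_addMonoidHom_rat, linearPeriods.finrank_eq,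
    Module.finrank_fintype_fun_eq_card]

theorem card_homology_one_dual_of_homeomorph_torus (e : realization A ≃ₜ UnitAddTorus ι)
    (D : Type u) [AddCommGroup D] :
    Nat.card ((chains A).homology 1 →+ D) = Nat.card D ^ Fintype.card ι := by
  rw [Nat.card_congr (homologyOneDualTorusEquiv e D).toEquiv, Nat.card_fun,
    Nat.card_eq_fintype_card (α := ι)]

end RegionHomeomorphicToTorus

section Entropy

theorem log_natCard_of_subsingleton (α : Type*) [Subsingleton α] :
    Real.log (Nat.card α) = 0 := by
  have : Nat.card α ≤ 1 := Finite.card_le_one_iff_subsingleton.mpr inferInstance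
  interval_cases Nat.card α <;> simp

theorem sum_range_sum_Icc_eq_of_add_ne_one {M : Type*} [AddCommMonoid M] {d : ℕ} {f : ℕ → ℕ → M}
    (hf : ∀ n p, n + p ≠ 1 → f n p = 0) (hd : d = 0 → f 0 1 = 0) :
    ∑ n ∈ Finset.range d, ∑ p ∈ Finset.Icc 1 d, f n p = f 0 1 := by
  obtain rfl | hpos := d.eq_zero_or_pos
  · simp [hd rfl]
  · rw [Finset.sum_eq_single_of_mem 0 (Finset.mem_range.mpr hpos),
      Finset.sum_eq_single_of_mem 1 (Finset.mem_Icc.mpr ⟨le_rfl, hpos⟩)]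
    · exact fun p _ hp => hf 0 p (by omega)
    · refine fun n _ hn => Finset.sum_eq_zero fun p hp => hf n p ?_
      have := (Finset.mem_Icc.mp hp).1
      omega

instance subsingleton_cohomology (C : ChainComplex AddCommGrpCat.{v} ℕ) (D : Type u)
    [AddCommGroup D] [Subsingleton D] (n : ℕ) : Subsingleton (Cohomology C D n) :=
  have : Subsingleton (C.X n →+ D) := DFunLike.subsingleton_cod
  QuotientAddGroup.mk_surjective.subsingleton

variable {V : Type v} {K A : PreAbstractSimplicialComplex V} {d : ℕ}

theorem isEmpty_simplices_of_card_le {n : ℕ} (hK : ∀ s ∈ K, s.card ≤ n) :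
    IsEmpty (Simplices K n) :=
  ⟨fun s => (hK s.1 s.2.1).not_gt (by simp [s.2.2])⟩

theorem isEmpty_simplices_entanglingSurface (hK : ∀ s ∈ K, s.card ≤ 1) :
    IsEmpty (Simplices (entanglingSurface K A) 0) := by
  refine ⟨fun ⟨s, ⟨hsA, t, ht, htA, hst⟩, hs⟩ => htA ?_⟩
  rwa [← Finset.eq_of_subset_of_card_le hst ((hK t ht).trans_eq hs.symm)]

variable {G : ChainComplex AddCommGrpCat.{u} ℕ}

theorem areaTerm_eq_of_subsingleton (hG : ∀ n, n ≠ 1 → Subsingleton (G.X n))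
    (hK : d = 0 → ∀ s ∈ K, s.card ≤ 1) :
    areaTerm d K A G =
      (Nat.card (Simplices (entanglingSurface K A) 0) : ℝ) * Real.log (Nat.card (G.X 1)) := by
  rw [areaTerm, sum_range_sum_Icc_eq_of_add_ne_one]
  · norm_num
  · intro n p h
    have := hG _ h
    rw [log_natCard_of_subsingleton, mul_zero]
  · intro hd
    have := isEmpty_simplices_entanglingSurface (A := A) (hK hd)
    simp

variable [LinearOrder V]

theorem subsingleton_homology_chains {n : ℕ} [IsEmpty (Simplices K n)] :
    Subsingleton ((chains K).homology n) :=
  have : Subsingleton ((chains K).X n) := inferInstanceAs (Subsingleton (Simplices K n →₀ ℤ))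
  inferInstance

theorem sum_log_card_cohomology_eq (hG : ∀ n, n ≠ 1 → Subsingleton (G.X n))
    (hK : d = 0 → ∀ s ∈ K, s.card ≤ 1) :
    ∑ n ∈ Finset.range (d + 1), Real.log (Nat.card (Cohomology (chains K) (G.homology n) n)) =
      Real.log (Nat.card ((chains K).homology 1 →+ G.X 1)) := by
  have := hG 0 zero_ne_one
  have := hG 2 (by norm_num)
  rw [Finset.sum_eq_single 1]
  · rw [Nat.card_congr ((cohomologyOneEquiv K _).trans
      (homologyEquivX G 1).addMonoidHomCongrRight).toEquiv]
  · intro n _ hn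
    have := hG n hn
    exact log_natCard_of_subsingleton _
  · intro hd
    have := isEmpty_simplices_of_card_le (hK (by simpa using hd))
    have := subsingleton_homology_chains (K := K) (n := 1)
    have := (cohomologyOneEquiv K (G.homology 1)).injective.subsingleton
    exact log_natCard_of_subsingleton _

theorem log_card_cohomology_zero [Finite V] (D : Type u) [AddCommGroup D] :
    Real.log (Nat.card (Cohomology (chains K) D 0)) =
      (betti (chains K) 0 : ℝ) * Real.log (Nat.card D) := by
  rw [Nat.card_congr (cohomologyZeroEquiv _ D).toEquiv, card_addMonoidHom_of_free, betti,
    Nat.cast_pow, Real.log_pow]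

theorem betti_eq_zero {n : ℕ} [IsEmpty (Simplices K n)] : betti (chains K) n = 0 :=
  have := subsingleton_homology_chains (K := K) (n := n)
  Module.finrank_zero_of_subsingleton

theorem sum_sum_log_card_cohomology_eq [Finite V] (hG : ∀ n, n ≠ 1 → Subsingleton (G.X n))
    (hK : d = 0 → IsEmpty (Simplices K 0)) :
    ∑ n ∈ Finset.range d, ∑ p ∈ Finset.Icc 1 d,
        (-1 : ℝ) ^ p * Real.log (Nat.card (Cohomology (chains K) (G.homology (n + p)) n)) =
      -(betti (chains K) 0 * Real.log (Nat.card (G.X 1))) := by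
  have := hG 0 zero_ne_one
  have := hG 2 (by norm_num)
  rw [sum_range_sum_Icc_eq_of_add_ne_one, pow_one, neg_one_mul, log_card_cohomology_zero]
  · rw [Nat.card_congr (homologyEquivX G 1).toEquiv]
  · intro n p h
    have := hG _ h
    rw [log_natCard_of_subsingleton, mul_zero]
  · intro hd
    have := hK hd
    rw [log_card_cohomology_zero, betti_eq_zero, Nat.cast_zero, zero_mul, mul_zero]

theorem topologicalTerm_eq_of_subsingleton [Finite V] (hG : ∀ n, n ≠ 1 → Subsingleton (G.X n))
    (hK : d = 0 → ∀ s ∈ K, s.card ≤ 1) (hA : d = 0 → A ≤ K) :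
    topologicalTerm d K A G =
      Real.log (Nat.card ((chains A).homology 1 →+ G.X 1))
        - (betti (chains (entanglingSurface K A)) 0 : ℝ) * Real.log (Nat.card (G.X 1)) := by
  rw [topologicalTerm, sum_log_card_cohomology_eq hG fun hd s hs => hK hd s (hA hd hs),
    sum_sum_log_card_cohomology_eq hG fun hd => isEmpty_simplices_entanglingSurface (hK hd),
    sub_eq_add_neg]

end Entropy

/-- For `d = 0` neither term involves the group `G₁`, so both right-hand sides have to vanish. -/
theorem mainTheorem4_general {V : Type v} [Fintype V] [LinearOrder V] {ι : Type*} [Fintype ι]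
    (d : ℕ) (K A : PreAbstractSimplicialComplex V)
    (hK : d = 0 → ∀ s ∈ K, s.card ≤ 1) (hA : d = 0 → A ≤ K)
    (G : ChainComplex AddCommGrpCat.{u} ℕ) [Finite (G.X 1)]
    (hG : ∀ n, n ≠ 1 → Subsingleton (G.X n)) :
    areaTerm d K A G =
        (Nat.card (Simplices (entanglingSurface K A) 0) : ℝ) * Real.log (Nat.card (G.X 1)) ∧
      topologicalTerm d K A G =
        Real.log (Nat.card ((chains A).homology 1 →+ G.X 1))
          - (betti (chains (entanglingSurface K A)) 0 : ℝ) * Real.log (Nat.card (G.X 1)) ∧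
      (Nonempty (realization A ≃ₜ UnitAddTorus ι) →
        betti (chains A) 1 = Fintype.card ι ∧
        topologicalTerm d K A G =
          ((betti (chains A) 1 : ℝ) - (betti (chains (entanglingSurface K A)) 0 : ℝ))
            * Real.log (Nat.card (G.X 1))) := by
  have topological := topologicalTerm_eq_of_subsingleton hG hK hA
  refine ⟨areaTerm_eq_of_subsingleton hG hK, topological, fun ⟨e⟩ => ?_⟩
  have betti_one := betti_one_of_homeomorph_torus e
  refine ⟨betti_one, ?_⟩
  rw [topological, card_homology_one_dual_of_homeomorph_torus e, betti_one, Nat.cast_pow,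
    Real.log_pow, sub_mul]

end GaugeEntropy

theorem mainTheorem4 {V : Type v} [Fintype V] [LinearOrder V] (d : ℕ)
    (K A : PreAbstractSimplicialComplex V)
    (hK : ∀ s ∈ K, s.card ≤ d + 1) (hA : A ≤ K)
    (G : ChainComplex AddCommGrpCat.{u} ℕ) [Finite (G.X 1)]
    (hG : ∀ n, n ≠ 1 → Subsingleton (G.X n)) :
    GaugeEntropy.areaTerm d K A G =
        (Nat.card (GaugeEntropy.Simplices (GaugeEntropy.entanglingSurface K A) 0) : ℝ)
          * Real.log (Nat.card (G.X 1)) ∧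
      GaugeEntropy.topologicalTerm d K A G =
        Real.log (Nat.card ((GaugeEntropy.chains A).homology 1 →+ G.X 1))
          - (GaugeEntropy.betti (GaugeEntropy.chains (GaugeEntropy.entanglingSurface K A)) 0 : ℝ)
            * Real.log (Nat.card (G.X 1)) ∧
      (Nonempty (GaugeEntropy.realization A ≃ₜ UnitAddTorus (Fin d)) →
        GaugeEntropy.betti (GaugeEntropy.chains A) 1 = d ∧
        GaugeEntropy.topologicalTerm d K A G =
          ((GaugeEntropy.betti (GaugeEntropy.chains A) 1 : ℝ)
            - (GaugeEntropy.betti (GaugeEntropy.chains (GaugeEntropy.entanglingSurface K A)) 0 : ℝ))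
            * Real.log (Nat.card (G.X 1))) := by
  simpa using GaugeEntropy.mainTheorem4_general (ι := Fin d) d K A
    (fun h s hs => by simpa [h] using hK s hs) (fun _ => hA) G hG
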